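/- Let $R$ be a commutative ring, regarded as a discrete topological ring. **Tate modules.** Let $\mathrm{Proj}^{fg}_R$ be the category of finitely generated projective $R$-modules with its split exact structure. A countable admissible pro-object is a formal limit $\lim_i P_i$ of an inverse system in $\mathrm{Proj}^{fg}_R$ indexed by a countable directed poset, with surjective transition maps; write $\mathrm{Pro}^a_{\aleph_0}$ for the category of these, with its exact structure of short exact sequences of left exact functors. A countable elementary Tate object is a formal filtered colimit of a diagram $(X_i)$ in $\mathrm{Pro}^a_{\aleph_0}$ indexed by a countable directed poset, whose transition maps $X_i\to X_j$ are admissible monomorphisms with cokernel in $\mathrm{Proj}^{fg}_R$. The category $\mathrm{Tate}_{\aleph_0,R}$ of countable Tate $R$-modules is the idempotent completion of the category of countable elementary Tate objects. **Topological and condensed modules.** Let $\mathrm{TopMod}_R$ be the category of linearly topologized topological $R$-modules and continuous $R$-linear maps, and $\mathrm{TopMod}^{cgwh}_R$ the full subcategory of those whose underlying space is compactly generated and weakly Hausdorff. The realization functor $\tau\colon \mathrm{Tate}_{\aleph_0,R}\to\mathrm{TopMod}_R$ realizes the formal limits and colimits of discrete finitely generated projective modules as limits and colimits in $\mathrm{TopMod}_R$.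 A condensed $R$-module is a sheaf of $R$-modules on the site of profinite sets (with finite jointly surjective families as covers) that is, for some uncountable strong limit cardinal $\kappa$, left Kan extended from profinite sets of cardinality $<\kappa$; they form the category $\mathrm{Cond}_R$. For $M\in\mathrm{TopMod}_R$ let $\underline M = C^0(-,M)$, with pointwise module structure. **Solid modules.** For a profinite set $S=\lim_i S_i$, with finite quotients $S_i$, let $R_\blacksquare[S]=\operatorname{colim}_{A\subseteq R}\lim_i A[S_i]$, where $A$ runs over the finitely generated subrings of $R$. A condensed $R$-module $M$ is solid if for every extremally disconnected profinite $S$ the map $\operatorname{Hom}(R_\blacksquare[S],M)\to M(S)$ given by restriction along $S\to R_\blacksquare[S]$ is bijective; let $\mathrm{Solid}_R\subseteq \mathrm{Cond}_R$ be the full subcategory of solid modules. **Proposition.** The functor $\tau$ takes values in $\mathrm{TopMod}^{cgwh}_R$; for every $M\in \mathrm{TopMod}^{cgwh}_R$ the sheaf $\underline M$ is a condensed $R$-module; and the composite functor $$\mathrm{TC}_R\colon \mathrm{Tate}_{\aleph_0,R}\xrightarrow{\ \tau\ }\mathrm{TopMod}^{cgwh}_R\xrightarrow{\ \underline{(-)}\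 }\mathrm{Cond}_R$$ is fully faithful. Moreover $\mathrm{TC}_R(V)$ is solid for every $V\in \mathrm{Tate}_{\aleph_0,R}$, so that $\mathrm{TC}_R$ factors through a fully faithful functor $\mathrm{TS}_R\colon\mathrm{Tate}_{\aleph_0,R}\to\mathrm{Solid}_R$. -/

import Mathlib

universe u

open CategoryTheory Opposite Limits

namespace TateCond

/-! ## Finitely generated projective modules -/

/-- A small model of the category of finitely generated projective `R`-modules: its objects are the
finitely generated projective submodules of the free modules `Rⁿ`.  See `ProjFG.exists_equiv`:
every finitely generated projective module is isomorphic to one of these. -/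
structure ProjFG (R : Type u) [CommRing R] : Type u where
  /-- The rank of the ambient free module. -/
  rank : ℕ
  /-- The underlying module. -/
  carrier : Submodule R (Fin rank → R)
  finite : Module.Finite R carrier
  projective : Module.Projective R carrier

theorem ProjFG.exists_equiv (R : Type u) [CommRing R] (M : Type u) [AddCommGroup M] [Module R M]
    [Module.Finite R M] [Module.Projective R M] :
    ∃ P : ProjFG R, Nonempty (M ≃ₗ[R] P.carrier) := by
  obtain ⟨n, f, hf⟩ := Module.Finite.exists_fin' R M
  obtain ⟨g, hg⟩ := Module.projective_lifting_property f LinearMap.id hf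
  have hinj : Function.Injective g := fun x y h => by
    have := congrArg f h
    rwa [← LinearMap.comp_apply, ← LinearMap.comp_apply, hg] at this
  let e := LinearEquiv.ofInjective g hinj
  exact ⟨⟨n, LinearMap.range g, Module.Finite.equiv e, Module.Projective.of_equiv e⟩, ⟨e⟩⟩

/-- The underlying `R`-module of an object of `ProjFG R`. -/
abbrev ProjFG.toModuleCat {R : Type u} [CommRing R] (P : ProjFG R) : ModuleCat.{u} R :=
  ModuleCat.of R P.carrier

/-- Morphisms are the `R`-linear maps. -/
instance (R : Type u) [CommRing R] : Category.{u} (ProjFG R) :=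
  inferInstanceAs (Category (InducedCategory (ModuleCat.{u} R) ProjFG.toModuleCat))

instance (R : Type u) [CommRing R] : Preadditive (ProjFG R) :=
  inferInstanceAs (Preadditive (InducedCategory (ModuleCat.{u} R) ProjFG.toModuleCat))

/-- The `R`-linear map underlying a morphism of `ProjFG R`. -/
def ProjFG.toLinearMap {R : Type u} [CommRing R] {P Q : ProjFG R} (f : P ⟶ Q) :
    P.carrier →ₗ[R] Q.carrier :=
  (InducedCategory.Hom.hom f).hom

/-- The morphism of `ProjFG R` given by an `R`-linear map. -/
def ProjFG.ofLinearMap {R : Type u} [CommRing R] {P Q : ProjFG R}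
    (f : P.carrier →ₗ[R] Q.carrier) : P ⟶ Q :=
  InducedCategory.homMk (ModuleCat.ofHom f)

/-- The free module of rank one. -/
def ProjFG.unit (R : Type u) [CommRing R] : ProjFG R where
  rank := 1
  carrier := ⊤
  finite := inferInstance
  projective := Module.Projective.of_equiv (Submodule.topEquiv (R := R) (M := Fin 1 → R)).symm

/-- Multiplication by `r`, as an endomorphism of the free module of rank one. -/
def ProjFG.scalar {R : Type u} [CommRing R] (r : R) : ProjFG.unit R ⟶ ProjFG.unit R :=
  ProjFG.ofLinearMap (r • LinearMap.id)

/-! ## Admissible pro-objects -/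

/-- A functor on `ProjFG R` is (the dual of) a countable admissible pro-object if it is a filtered
colimit of corepresentable functors `Hom(Pᵢ, -)` along an inverse system `P` of finitely generated
projective modules, indexed by a countable directed poset, whose transition maps are admissible
epimorphisms (that is, surjections: the kernel is automatically finitely generated projective). -/
def isAdmissiblePro (R : Type u) [CommRing R] : ObjectProperty (ProjFG R ⥤ AddCommGrpCat.{u}) :=
  fun F => ∃ (I : Type u) (_ : PartialOrder I) (_ : IsDirectedOrder I) (_ : Nonempty I)
    (_ : Countable I) (P : Iᵒᵖ ⥤ ProjFG R) (c : Cocone (P.rightOp ⋙ preadditiveCoyoneda)),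
    (∀ ⦃i j : Iᵒᵖ⦄ (h : i ⟶ j), Function.Surjective (ProjFG.toLinearMap (P.map h))) ∧
      Nonempty (IsColimit c) ∧ Nonempty (c.pt ≅ F)

/-- The category of countable admissible pro-objects of the category of finitely generated
projective modules.  A formal limit `lim Pᵢ` is encoded by the functor
`Q ↦ Hom(lim Pᵢ, Q) = colim Hom(Pᵢ, Q)`; morphisms of pro-objects are the natural transformations
in the opposite direction. -/
abbrev ProA (R : Type u) [CommRing R] : Type (u + 1) := (isAdmissiblePro R).FullSubcategoryᵒᵖ

theorem isAdmissiblePro_coyoneda (R : Type u) [CommRing R] (P : (ProjFG R)ᵒᵖ) :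
    isAdmissiblePro R (preadditiveCoyoneda.obj P) := by
  refine ⟨PUnit, inferInstance, inferInstance, inferInstance, inferInstance,
    (Functor.const _).obj P.unop,
    { pt := preadditiveCoyoneda.obj P, ι := { app := fun _ => 𝟙 _ } }, ?_, ⟨?_⟩, ⟨Iso.refl _⟩⟩
  · intro i j h x
    exact ⟨x, rfl⟩
  · exact
      { desc := fun s => s.ι.app PUnit.unit
        fac := by
          rintro s ⟨⟩
          exact Category.id_comp _
        uniq := by
          intro s m hm
          rw [← hm PUnit.unit]
          exact (Category.id_comp _).symm }

/-- The embedding of finitely generated projective modules as constant pro-objects. -/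
def const (R : Type u) [CommRing R] : ProjFG R ⥤ ProA R :=
  ((isAdmissiblePro R).lift preadditiveCoyoneda (isAdmissiblePro_coyoneda R)).rightOp

instance (R : Type u) [CommRing R] : (const R).Additive where
  map_add {P Q f g} := by
    apply Quiver.Hom.unop_inj
    apply ObjectProperty.hom_ext
    ext T x
    exact Preadditive.add_comp _ _ _ f g x

/-- A sequence `X ⟶ Y ⟶ Z` of pro-objects is a conflation if it is short exact as a sequence of left
exact functors on the category of finitely generated projective modules.  The exact structure of
that category is split, so that this is exactness in the abelian category of all functors. -/
def IsConflation {R : Type u} [CommRing R] {X Y Z : ProA R} (f : X ⟶ Y) (g : Y ⟶ Z) : Prop :=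
  ∃ w : g.unop.hom ≫ f.unop.hom = 0, (ShortComplex.mk g.unop.hom f.unop.hom w).ShortExact

/-! ## Tate modules -/

/-- Countable elementary Tate objects: the additive presheaves on pro-objects that are filtered
colimits of the representable presheaves of an elementary Tate diagram `X`, i.e. a diagram of
admissible pro-objects indexed by a countable directed poset whose transition maps `Xᵢ ⟶ Xⱼ` are
admissible monomorphisms with cokernel a finitely generated projective module. -/
def isElementaryTate (R : Type u) [CommRing R] :
    ObjectProperty ((ProA R)ᵒᵖ ⥤+ AddCommGrpCat.{u}) :=
  fun V => ∃ (I : Type u) (_ : PartialOrder I) (_ : IsDirectedOrder I) (_ : Nonempty I)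
    (_ : Countable I) (X : I ⥤ ProA R) (c : Cocone (X ⋙ preadditiveYoneda)),
    (∀ ⦃i j : I⦄ (h : i ⟶ j), ∃ (P : ProjFG R) (q : X.obj j ⟶ (const R).obj P),
      IsConflation (X.map h) q) ∧
      Nonempty (IsColimit c) ∧ Nonempty (c.pt ≅ V.obj)

/-- The category of countable Tate `R`-modules: the idempotent completion of the category of
countable elementary Tate objects, formed inside the (idempotent complete) category of additive
presheaves on pro-objects. -/
abbrev Tate (R : Type u) [CommRing R] : Type (u + 1) :=
  (isElementaryTate R).retractClosure.FullSubcategory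

/-! ## Linearly topologized modules -/

/-- A topological module over a discrete ring is linearly topologized if the open submodules form a
basis of neighbourhoods of zero. -/
def isLinTop (R : Type u) [CommRing R] [TopologicalSpace R] :
    ObjectProperty (TopModuleCat.{u} R) :=
  fun M => IsLinearTopology R M

/-- The category of linearly topologized topological `R`-modules and continuous linear maps. -/
abbrev TopMod (R : Type u) [CommRing R] [TopologicalSpace R] : Type (u + 1) :=
  (isLinTop R).FullSubcategory

/-- Weakly Hausdorff spaces: the image of every continuous map from a compact Hausdorff space is
closed. -/
def WeaklyHausdorff (X : Type u) [TopologicalSpace X] : Prop :=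
  ∀ (K : CompHaus.{u}) (f : C(K, X)), IsClosed (Set.range f)

/-- Linearly topologized modules whose underlying space is compactly generated and weakly
Hausdorff. -/
def isCGWH (R : Type u) [CommRing R] [TopologicalSpace R] : ObjectProperty (TopMod R) :=
  fun M => CompactlyGeneratedSpace M.obj ∧ WeaklyHausdorff M.obj

/-- The category of linearly topologized modules whose underlying space is compactly generated and
weakly Hausdorff. -/
abbrev TopModCGWH (R : Type u) [CommRing R] [TopologicalSpace R] : Type (u + 1) :=
  (isCGWH R).FullSubcategory

/-- A family of submodules which is to be the family of all open submodules (or a basis of it) of a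
linear topology. -/
structure OpenFamily (R : Type u) [CommRing R] (M : Type u) [AddCommGroup M] [Module R M] where
  /-- The submodules of the family. -/
  sets : Set (Submodule R M)
  top_mem : ⊤ ∈ sets
  inf_mem : ∀ U ∈ sets, ∀ V ∈ sets, U ⊓ V ∈ sets

namespace OpenFamily

variable {R : Type u} [CommRing R] [TopologicalSpace R] [DiscreteTopology R]
  {M : Type u} [AddCommGroup M] [Module R M] (B : OpenFamily R M)

instance : Nonempty B.sets := ⟨⟨⊤, B.top_mem⟩⟩

theorem basis : SubmodulesBasis (R := R) (fun U : B.sets => (U : Submodule R M)) where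
  inter i j := ⟨⟨i.1 ⊓ j.1, B.inf_mem _ i.2 _ j.2⟩, le_rfl⟩
  smul m i := by
    rw [nhds_discrete]
    exact Filter.eventually_pure.2 (by simp)

/-- The linear topology with the submodules of the family as basis of neighbourhoods of zero. -/
abbrev topology : TopologicalSpace M := B.basis.topology

theorem hasBasis :
    (@nhds M B.topology 0).HasBasis (fun U => U ∈ B.sets) (fun U => (U : Set M)) := by
  have h := B.basis.toModuleFilterBasis.toAddGroupFilterBasis.nhds_zero_hasBasis
  refine ⟨fun t => (h.mem_iff).trans ⟨?_, ?_⟩⟩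
  · rintro ⟨_, ⟨U, rfl⟩, hU⟩
    exact ⟨U.1, U.2, hU⟩
  · rintro ⟨U, hU, hUt⟩
    exact ⟨(U : Set M), ⟨⟨U, hU⟩, rfl⟩, hUt⟩

/-- The module `M` with the linear topology defined by the family `B`. -/
def toTopMod : TopMod R :=
  letI := B.topology
  haveI : IsTopologicalAddGroup M :=
    B.basis.toModuleFilterBasis.toAddGroupFilterBasis.isTopologicalAddGroup
  haveI : ContinuousSMul R M := B.basis.toModuleFilterBasis.continuousSMul
  ⟨TopModuleCat.of R M, IsLinearTopology.mk_of_hasBasis R B.hasBasis⟩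

/-- A linear map such that the preimage of every submodule of the target family belongs to the
source family is continuous. -/
def homMk {N : Type u} [AddCommGroup N] [Module R N] {B : OpenFamily R M} {B' : OpenFamily R N}
    (f : M →ₗ[R] N) (hf : ∀ U ∈ B'.sets, U.comap f ∈ B.sets) : B.toTopMod ⟶ B'.toTopMod :=
  letI := B.topology
  letI := B'.topology
  haveI : IsTopologicalAddGroup M :=
    B.basis.toModuleFilterBasis.toAddGroupFilterBasis.isTopologicalAddGroup
  haveI : ContinuousSMul R M := B.basis.toModuleFilterBasis.continuousSMul
  haveI : IsTopologicalAddGroup N :=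
    B'.basis.toModuleFilterBasis.toAddGroupFilterBasis.isTopologicalAddGroup
  haveI : ContinuousSMul R N := B'.basis.toModuleFilterBasis.continuousSMul
  ObjectProperty.homMk (TopModuleCat.ofHom
    { toLinearMap := f
      cont := by
        refine continuous_of_continuousAt_zero f ?_
        rw [ContinuousAt, map_zero]
        exact (B.hasBasis.tendsto_iff B'.hasBasis).2 fun U hU => ⟨_, hf U hU, fun x hx => hx⟩ })

end OpenFamily

/-! ## The realization functor -/

section Realization

variable {R : Type u} [CommRing R]

/-- The pro-object represented by the free module of rank one. -/
abbrev unitPro (R : Type u) [CommRing R] : ProA R := (const R).obj (ProjFG.unit R)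

/-- The value of an additive presheaf on pro-objects at the free module of rank one.  By the
co-Yoneda lemma this is the colimit, over all pairs `(X, v)` of a pro-object `X` and `v ∈ V(X)`, of
the modules `Hom(R, X)`; for a pro-object `X = lim Pᵢ`, the module `Hom(R, X)` is `lim Pᵢ`. -/
abbrev Points (V : (ProA R)ᵒᵖ ⥤+ AddCommGrpCat.{u}) : Type u := V.obj.obj (op (unitPro R))

/-- The restriction of `v ∈ V(X)` along `f : R ⟶ X`. -/
def pull (V : (ProA R)ᵒᵖ ⥤+ AddCommGrpCat.{u}) {X : ProA R} (f : unitPro R ⟶ X)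
    (v : V.obj.obj (op X)) : Points V :=
  V.obj.map f.op v

theorem pull_add_left (V : (ProA R)ᵒᵖ ⥤+ AddCommGrpCat.{u}) {X : ProA R} (f g : unitPro R ⟶ X)
    (v : V.obj.obj (op X)) : pull V (f + g) v = pull V f v + pull V g v := by
  have : V.obj.map (f + g).op = V.obj.map f.op + V.obj.map g.op := by
    rw [op_add, Functor.map_add]
  unfold pull
  rw [this]
  rfl

theorem pull_add_right (V : (ProA R)ᵒᵖ ⥤+ AddCommGrpCat.{u}) {X : ProA R} (f : unitPro R ⟶ X)
    (v w : V.obj.obj (op X)) : pull V f (v + w) = pull V f v + pull V f w :=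
  map_add (V.obj.map f.op).hom v w

theorem pull_comp (V : (ProA R)ᵒᵖ ⥤+ AddCommGrpCat.{u}) {X : ProA R} (f : unitPro R ⟶ unitPro R)
    (g : unitPro R ⟶ X) (v : V.obj.obj (op X)) : pull V (f ≫ g) v = pull V f (pull V g v) := by
  unfold pull
  rw [op_comp, Functor.map_comp]
  rfl

theorem pull_id (V : (ProA R)ᵒᵖ ⥤+ AddCommGrpCat.{u}) (v : Points V) :
    pull V (𝟙 (unitPro R)) v = v := by
  unfold pull
  rw [op_id, CategoryTheory.Functor.map_id]
  rfl

theorem ProjFG.scalar_one : ProjFG.scalar (1 : R) = 𝟙 _ := by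
  unfold ProjFG.scalar; rw [one_smul]; rfl

theorem ProjFG.scalar_add (r s : R) :
    ProjFG.scalar (r + s) = ProjFG.scalar r + ProjFG.scalar s := by
  unfold ProjFG.scalar; rw [add_smul]; rfl

theorem ProjFG.scalar_mul (r s : R) :
    ProjFG.scalar (r * s) = ProjFG.scalar r ≫ ProjFG.scalar s := by
  unfold ProjFG.scalar; rw [mul_comm, mul_smul]; rfl

/-- The ring `R` acts on `V(R)` through the endomorphisms of `R`. -/
instance (V : (ProA R)ᵒᵖ ⥤+ AddCommGrpCat.{u}) : Module R (Points V) where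
  smul r v := pull V ((const R).map (ProjFG.scalar r)) v
  one_smul v := by
    change pull V ((const R).map (ProjFG.scalar 1)) v = v
    rw [ProjFG.scalar_one, CategoryTheory.Functor.map_id, pull_id]
  mul_smul r s v := by
    change pull V _ v = pull V _ (pull V _ v)
    rw [ProjFG.scalar_mul, Functor.map_comp, pull_comp]
  smul_zero r := map_zero (V.obj.map _).hom
  smul_add r v w := pull_add_right V _ v w
  add_smul r s v := by
    change pull V _ v = pull V _ v + pull V _ v
    rw [ProjFG.scalar_add, Functor.map_add, pull_add_left]
  zero_smul v := by
    have h := pull_add_left V ((const R).map (ProjFG.scalar 0))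
      ((const R).map (ProjFG.scalar 0)) v
    rw [← Functor.map_add, ← ProjFG.scalar_add, add_zero] at h
    exact left_eq_add.1 h

theorem smul_def (V : (ProA R)ᵒᵖ ⥤+ AddCommGrpCat.{u}) (r : R) (v : Points V) :
    r • v = pull V ((const R).map (ProjFG.scalar r)) v := rfl

/-- A morphism of presheaves induces a linear map. -/
def Points.map {V W : (ProA R)ᵒᵖ ⥤+ AddCommGrpCat.{u}} (φ : V ⟶ W) : Points V →ₗ[R] Points W where
  toFun v := φ.hom.app (op (unitPro R)) v
  map_add' v w := map_add (φ.hom.app _).hom v w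
  map_smul' r v := NatTrans.naturality_apply φ.hom ((const R).map (ProjFG.scalar r)).op v

/-- A pro-object, seen as a representable presheaf. -/
abbrev yonedaPro : ProA R ⥤ ((ProA R)ᵒᵖ ⥤+ AddCommGrpCat.{u}) :=
  ObjectProperty.lift _ preadditiveYoneda (fun X => additive_yonedaObj' X)

/-- For `V` an additive presheaf and `v ∈ V(X)`, the linear map `Hom(R, X) → V(R)`; it is the
realization of the morphism from (the presheaf represented by) `X` to `V` defined by `v`. -/
def pullLinear (V : (ProA R)ᵒᵖ ⥤+ AddCommGrpCat.{u}) {X : ProA R} (v : V.obj.obj (op X)) :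
    Points (yonedaPro.obj X) →ₗ[R] Points V where
  toFun f := pull V f v
  map_add' f g := pull_add_left V f g v
  map_smul' _ f := pull_comp V _ f v

/-- The linear map `Hom(R, X) → Hom(R, P)` induced by `q : X ⟶ P`. -/
abbrev proj {X : ProA R} {P : ProjFG R} (q : X ⟶ (const R).obj P) :
    Points (yonedaPro.obj X) →ₗ[R] Points (yonedaPro.obj ((const R).obj P)) :=
  Points.map (yonedaPro.map q)

/-- The open submodules of the limit topology on `Hom(R, X) = lim Pᵢ`: those containing a finite
intersection of kernels of maps `Hom(R, X) → Hom(R, P) = P` with `P` finitely generated projective,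
equipped with the discrete topology. -/
def proOpens (X : ProA R) : OpenFamily R (Points (yonedaPro.obj X)) where
  sets := {U | ∃ s : Set (Σ P : ProjFG R, X ⟶ (const R).obj P), s.Finite ∧
    ⨅ q ∈ s, LinearMap.ker (proj q.2) ≤ U}
  top_mem := ⟨∅, Set.finite_empty, le_top⟩
  inf_mem := by
    rintro U ⟨s, hs, hU⟩ V ⟨t, ht, hV⟩
    refine ⟨s ∪ t, hs.union ht, ?_⟩
    rw [iInf_union]
    exact inf_le_inf hU hV

/-- The open submodules of the colimit topology on `V(R)` (the finest linear topology for which the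
realizations of all morphisms from pro-objects to `V` are continuous): those whose preimage under
every map `Hom(R, X) → V(R)` defined by an element of `V(X)` is open. -/
def tateOpens (V : (ProA R)ᵒᵖ ⥤+ AddCommGrpCat.{u}) : OpenFamily R (Points V) where
  sets := {U | ∀ (X : ProA R) (v : V.obj.obj (op X)), U.comap (pullLinear V v) ∈ (proOpens X).sets}
  top_mem := fun X v => by
    rw [Submodule.comap_top]
    exact (proOpens X).top_mem
  inf_mem := fun U hU W hW X v => by
    rw [Submodule.comap_inf]
    exact (proOpens X).inf_mem _ (hU X v) _ (hW X v)

theorem comap_map_mem_tateOpens {V W : (ProA R)ᵒᵖ ⥤+ AddCommGrpCat.{u}} (φ : V ⟶ W)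
    (U : Submodule R (Points W)) (hU : U ∈ (tateOpens W).sets) :
    U.comap (Points.map φ) ∈ (tateOpens V).sets := by
  intro X v
  have h := hU X (φ.hom.app (op X) v)
  have e : Points.map φ ∘ₗ pullLinear V v = pullLinear W (φ.hom.app (op X) v) := by
    ext f
    exact NatTrans.naturality_apply φ.hom f.op v
  rwa [← e, Submodule.comap_comp] at h

variable (R) [TopologicalSpace R] [DiscreteTopology R]

/-- Realization of additive presheaves on pro-objects: the colimit, over the category of pairs
`(X, v)` of a pro-object `X` and `v ∈ V(X)`, of the realizations of the pro-objects `X`, where a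
pro-object is realized as the limit of the discrete modules `P` over the category of pairs `(P, q)`
of a finitely generated projective module and a morphism `q : X ⟶ P`. -/
def presheafRealization : ((ProA R)ᵒᵖ ⥤+ AddCommGrpCat.{u}) ⥤ TopMod R where
  obj V := (tateOpens V).toTopMod
  map φ := OpenFamily.homMk (Points.map φ) (comap_map_mem_tateOpens φ)
  map_id V := by
    apply ObjectProperty.hom_ext
    rfl
  map_comp φ ψ := by
    apply ObjectProperty.hom_ext
    rfl

/-- The realization functor `τ` from countable Tate modules to linearly topologized modules. -/
def realization : Tate R ⥤ TopMod R :=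
  (isElementaryTate R).retractClosure.ι ⋙ presheafRealization R

end Realization

/-! ## Condensed modules -/

section Condensed

variable (R : Type u) [CommRing R]

/-- Sheaves of `R`-modules on the site of profinite sets, with the topology generated by finite
jointly surjective families. -/
abbrev ProfiniteSheaf : Type (u + 1) :=
  Sheaf (coherentTopology Profinite.{u}) (ModuleCat.{u} R)

/-- The profinite sets of cardinality less than `κ`. -/
def isSmallProfinite (κ : Cardinal.{u}) : ObjectProperty Profinite.{u} :=
  fun S => Cardinal.mk S < κ

/-- A sheaf of `R`-modules on profinite sets is a condensed `R`-module if, for some uncountable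
strong limit cardinal `κ`, it is the left Kan extension of its restriction to `κ`-small profinite
sets. -/
def isCondensed : ObjectProperty (ProfiniteSheaf R) :=
  fun F => ∃ κ : Cardinal.{u}, Cardinal.aleph0 < κ ∧ κ.IsStrongLimit ∧
    F.obj.IsLeftKanExtension (L := (isSmallProfinite κ).ι.op) (F := (isSmallProfinite κ).ι.op ⋙ F.obj)
      (𝟙 _)

/-- The category of condensed `R`-modules. -/
abbrev Cond : Type (u + 1) := (isCondensed R).FullSubcategory

variable {R} [TopologicalSpace R]

/-- The presheaf `C⁰(-, M)`, with pointwise module structure. -/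
def contPresheaf (M : TopModuleCat.{u} R) : Profinite.{u}ᵒᵖ ⥤ ModuleCat.{u} R where
  obj T := ModuleCat.of R C(T.unop, M)
  map {S T} g := ModuleCat.ofHom
    { toFun f := f.comp g.unop.hom.hom
      map_add' _ _ := rfl
      map_smul' _ _ := rfl }

theorem isSheaf_contPresheaf (M : TopModuleCat.{u} R) :
    Presheaf.IsSheaf (coherentTopology Profinite.{u}) (contPresheaf M) := by
  refine Presheaf.isSheaf_coherent_of_hasPullbacks_of_comp _ (CategoryTheory.forget _) ?_
  exact (TopCat.toSheafCompHausLike.{u, u} _ (TopCat.of M)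
    (fun _ _ f => ((Profinite.effectiveEpi_tfae f).out 0 2).mp)).property

/-- The functor `M ↦ C⁰(-, M)` from topological modules to sheaves of modules on profinite sets. -/
def contSheaf : TopModuleCat.{u} R ⥤ ProfiniteSheaf R where
  obj M := ⟨contPresheaf M, isSheaf_contPresheaf M⟩
  map {M N} φ := ⟨{
    app T := ModuleCat.ofHom
      { toFun f := (⟨φ.hom, φ.hom.continuous⟩ : C(M, N)).comp f
        map_add' f g := by ext x; exact map_add φ.hom (f x) (g x)
        map_smul' r f := by ext x; exact map_smul φ.hom r (f x) }
    naturality _ _ _ := rfl }⟩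

variable (R) in
/-- The functor `M ↦ C⁰(-, M)` on linearly topologized modules. -/
def underline : TopMod R ⥤ ProfiniteSheaf R := (isLinTop R).ι ⋙ contSheaf

end Condensed

/-! ## Solid modules -/

section Solid

variable (R : Type u) [CommRing R] (S : Profinite.{u})

/-- The `R`-module `lim R[Sᵢ]`, where `Sᵢ` runs over the finite quotients of the profinite set `S`
and `R[Sᵢ]` is the free `R`-module on `Sᵢ`. -/
def limFree : Submodule R (∀ i : DiscreteQuotient S, i →₀ R) where
  carrier := {μ | ∀ (i j : DiscreteQuotient S) (h : i ≤ j),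
    Finsupp.mapDomain (DiscreteQuotient.ofLE h) (μ i) = μ j}
  add_mem' {μ ν} hμ hν i j h := by
    simp only [Pi.add_apply, Finsupp.mapDomain_add, hμ i j h, hν i j h]
  zero_mem' i j h := by simp
  smul_mem' r μ hμ i j h := by
    simp only [Pi.smul_apply, Finsupp.mapDomain_smul, hμ i j h]

/-- The projection `lim R[Sᵢ] → R[Sᵢ]`. -/
noncomputable def limFreeProj (i : DiscreteQuotient S) : limFree R S →ₗ[R] (i →₀ R) :=
  LinearMap.proj i ∘ₗ (limFree R S).subtype

theorem ker_limFreeProj_mono {i j : DiscreteQuotient S} (h : i ≤ j) :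
    LinearMap.ker (limFreeProj R S i) ≤ LinearMap.ker (limFreeProj R S j) := by
  intro μ hμ
  rw [LinearMap.mem_ker] at hμ ⊢
  have h' := μ.2 i j h
  change μ.1 i = 0 at hμ
  change μ.1 j = 0
  rw [← h', hμ, Finsupp.mapDomain_zero]

/-- The open submodules of the limit topology on `lim R[Sᵢ]`, the modules `R[Sᵢ]` being discrete. -/
noncomputable def limFreeOpens : OpenFamily R (limFree R S) where
  sets := {U | ∃ i : DiscreteQuotient S, LinearMap.ker (limFreeProj R S i) ≤ U}
  top_mem := ⟨⊤, le_top⟩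
  inf_mem := by
    rintro U ⟨i, hi⟩ V ⟨j, hj⟩
    exact ⟨i ⊓ j, le_inf ((ker_limFreeProj_mono R S inf_le_left).trans hi)
      ((ker_limFreeProj_mono R S inf_le_right).trans hj)⟩

variable [TopologicalSpace R] [DiscreteTopology R]

/-- The topological `R`-module `lim R[Sᵢ]`, with the limit topology. -/
noncomputable abbrev limFreeTop : TopModuleCat.{u} R := (limFreeOpens R S).toTopMod.obj

variable {R S} in
/-- The coefficients of an element of `lim R[Sᵢ]`. -/
noncomputable def coeff (μ : limFreeTop R S) (i : DiscreteQuotient S) : i →₀ R :=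
  limFreeProj R S i μ

/-- The sections over `T` of the condensed module `R_■[S] = colim_{A ⊆ R} lim A[Sᵢ]`, where `A`
runs over the finitely generated subrings of `R`.  The modules `lim A[Sᵢ]` are submodules of
`lim R[Sᵢ]`, so that the filtered colimit is a union: the sections are the continuous maps
`T → lim R[Sᵢ]` with values in `lim A[Sᵢ]` for some finitely generated subring `A`. -/
noncomputable def solidSections (T : Profinite.{u}) : Submodule R C(T, limFreeTop R S) where
  carrier := {f | ∃ A : Set R, A.Finite ∧
    ∀ (t : T) (i : DiscreteQuotient S) (a : i), coeff (f t) i a ∈ Subring.closure A}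
  add_mem' := by
    rintro f g ⟨A, hA, hf⟩ ⟨B, hB, hg⟩
    exact ⟨A ∪ B, hA.union hB, fun t i a =>
      add_mem (Subring.closure_mono Set.subset_union_left (hf t i a))
        (Subring.closure_mono Set.subset_union_right (hg t i a))⟩
  zero_mem' := ⟨∅, Set.finite_empty, fun t i a => zero_mem _⟩
  smul_mem' := by
    rintro r f ⟨A, hA, hf⟩
    exact ⟨insert r A, hA.insert r, fun t i a =>
      mul_mem (Subring.subset_closure (Set.mem_insert r A))
        (Subring.closure_mono (Set.subset_insert r A) (hf t i a))⟩

/-- The presheaf of sections of `R_■[S]`. -/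
noncomputable def solidPresheaf : Profinite.{u}ᵒᵖ ⥤ ModuleCat.{u} R where
  obj T := ModuleCat.of R (solidSections R S T.unop)
  map {T T'} g := ModuleCat.ofHom
    (((contPresheaf (limFreeTop R S)).map g).hom.restrict
      (p := solidSections R S T.unop) (q := solidSections R S T'.unop) (by
        rintro f ⟨A, hA, hf⟩
        exact ⟨A, hA, fun t i a => hf _ i a⟩))

theorem isSheaf_solidPresheaf :
    Presheaf.IsSheaf (coherentTopology Profinite.{u}) (solidPresheaf R S) := by
  refine Presheaf.isSheaf_coherent_of_hasPullbacks_of_comp _ (CategoryTheory.forget _) ?_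
  let F : Profinite.{u}ᵒᵖ ⥤ Type u := contPresheaf (limFreeTop R S) ⋙ CategoryTheory.forget _
  have h : Presieve.IsSheaf (coherentTopology Profinite.{u}) F :=
    (isSheaf_iff_isSheaf_of_type _ _).1
      (TopCat.toSheafCompHausLike.{u, u} _ (TopCat.of (limFreeTop R S))
        (fun _ _ f => ((Profinite.effectiveEpi_tfae f).out 0 2).mp)).property
  rw [isSheaf_iff_isSheaf_of_type]
  let G : Subfunctor F :=
    { obj T := {f | f ∈ solidSections R S T.unop}
      map g := by
        rintro f ⟨A, hA, hf⟩
        exact ⟨A, hA, fun t i a => hf _ i a⟩ }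
  have hG : Presieve.IsSheaf (coherentTopology Profinite.{u}) G.toFunctor := by
    rw [Subfunctor.isSheaf_iff _ h]
    intro T f hf
    obtain ⟨α, _, Y, π, hπ, hY⟩ := (coherentTopology.mem_sieves_iff_hasEffectiveEpiFamily _).1 hf
    choose A hA hfA using hY
    refine ⟨⋃ a, A a, Set.finite_iUnion hA, fun t i a => ?_⟩
    have hs : ∀ b : T.unop, ∃ (a : α) (x : Y a), π a x = b :=
      ((Profinite.effectiveEpiFamily_tfae Y π).out 0 2).1 hπ
    obtain ⟨k, y, rfl⟩ := hs t
    exact Subring.closure_mono (Set.subset_iUnion A k) (hfA k y i a)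
  exact hG

/-- The sheaf `R_■[S] = colim_{A ⊆ R} lim A[Sᵢ]` of `R`-modules on profinite sets. -/
noncomputable def solidFree : ProfiniteSheaf R := ⟨solidPresheaf R S, isSheaf_solidPresheaf R S⟩

/-- The Dirac measure at `s`, as an element of `lim R[Sᵢ]`. -/
noncomputable def dirac (s : S) : limFreeTop R S :=
  (⟨fun i => Finsupp.single (i.proj s) 1, fun i j h => by
    rw [Finsupp.mapDomain_single, DiscreteQuotient.ofLE_proj]⟩ : limFree R S)

theorem continuous_dirac : Continuous (dirac R S) := by
  rw [continuous_iff_continuousAt]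
  intro s
  rw [ContinuousAt, ← tendsto_sub_nhds_zero_iff]
  refine (limFreeOpens R S).hasBasis.tendsto_right_iff.2 ?_
  rintro U ⟨i, hi⟩
  filter_upwards [(i.isOpen_preimage {i.proj s}).mem_nhds rfl] with s' hs'
  refine hi (LinearMap.mem_ker.2 ?_)
  change Finsupp.single (i.proj s') (1 : R) - Finsupp.single (i.proj s) 1 = 0
  rw [show i.proj s' = i.proj s from hs', sub_self]

/-- The canonical section of `R_■[S]` over `S`, given by the Dirac measures.  It corresponds to the
canonical map `S → R_■[S]`. -/
noncomputable def diracSection : solidSections R S S :=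
  ⟨⟨dirac R S, continuous_dirac R S⟩, ∅, Set.finite_empty, fun s i a => by
    change Finsupp.single (i.proj s) (1 : R) a ∈ _
    classical
    rw [Finsupp.single_apply]
    split_ifs
    · exact one_mem _
    · exact zero_mem _⟩

variable {R} in
/-- Evaluation of a morphism `R_■[S] ⟶ M` at the canonical section, i.e. its restriction along
`S → R_■[S]`. -/
noncomputable def restrictDirac (M : ProfiniteSheaf R) (φ : solidFree R S ⟶ M) : M.obj.obj (op S) :=
  φ.hom.app (op S) (diracSection R S)

/-- A condensed `R`-module `M` is solid if for every extremally disconnected profinite set `S` the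
map `Hom(R_■[S], M) → M(S)` is a bijection. -/
def isSolid : ObjectProperty (Cond R) :=
  fun M => ∀ S : Profinite.{u}, ExtremallyDisconnected S →
    Function.Bijective (restrictDirac S M.obj)

/-- The category of solid `R`-modules. -/
abbrev Solid : Type (u + 1) := (isSolid R).FullSubcategory

end Solid

end TateCond

/-! Countable directed posets have cofinal sequences. A pro-object is therefore the limit of a
sequence of surjections between finitely generated projective modules. A conflation X → Y → P with P
finitely generated projective splits, because the maps X → Pₙ extend to Y compatibly, by
projectivity of P (`IsConflation.exists_splitting`). So an elementary Tate object is a union of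
steps Xₙ with Xₙ₊₁ = Xₙ ⊕ Pₙ. Since Pₙ is discrete, X₀ is open in the realization, which is thus
separated and complete with a countable basis of open submodules. First countability and the
Hausdorff property give the compactly generated weakly Hausdorff condition, and both pass to
retracts.

The realization is fully faithful for two reasons. A continuous map from a pro-object to a discrete
module factors through a stage. A continuous map from a pro-object to an elementary Tate object
lands in one step Xₖ: the open X₀ absorbs the kernel of some X → Pₘ, and Pₘ is finitely generated
(`TatePresentation.exists_pullLinear_eq`). The functor C⁰(-, M) is fully faithful on compactly
generated modules, because continuity there is tested on profinite sets. It is condensed because a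
map T → M factors through its image, a profinite set of size at most |M|.

For solidity, existence of an extension of f : S → M to measures is integration: Riemann sums
converge by completeness. Uniqueness is the delicate point (`eq_zero_of_boundedDirac`), since
continuity is known only on sections with coefficients in a finitely generated subring A. By
Nöbeling's theorem, locally constant integral functions on S have a basis I, so measures over A are
families in A^I. The truncations of a family form a section over the profinite set {0,1}^I, so
modulo an open submodule N a morphism D kills tails. For the constant family 1 this gives a finite
J₀, independent of the measure, outside which the basis measures lie in D⁻¹(N). Hence D mod N
depends only on the J₀-coordinates, and these can be matched by a combination of Dirac measures. -/

namespace TateCond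

/-! ### Pro-objects as sequential limits, and splitting of conflations -/

section ProObjects

variable {R : Type u} [CommRing R]

theorem ProjFG.toLinearMap_injective {P Q : ProjFG R} {f g : P ⟶ Q}
    (h : ProjFG.toLinearMap f = ProjFG.toLinearMap g) : f = g :=
  InducedCategory.hom_ext (ModuleCat.hom_ext h)

/-- Maps of finitely generated projective modules that are surjective are epimorphisms. -/
theorem ProjFG.cancel_surjective {P Q S : ProjFG R} {f : P ⟶ Q}
    (hf : Function.Surjective (ProjFG.toLinearMap f)) {g h : Q ⟶ S} (e : f ≫ g = f ≫ h) :
    g = h := by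
  apply ProjFG.toLinearMap_injective
  ext1 x
  obtain ⟨y, rfl⟩ := hf x
  exact LinearMap.congr_fun (congrArg ProjFG.toLinearMap e) y

/-- Maps out of a projective module lift through surjections. -/
theorem ProjFG.exists_lift {P Q S : ProjFG R} {f : P ⟶ Q}
    (hf : Function.Surjective (ProjFG.toLinearMap f)) (g : S ⟶ Q) : ∃ h : S ⟶ P, h ≫ f = g := by
  have := S.projective
  obtain ⟨h, hh⟩ := Module.projective_lifting_property (ProjFG.toLinearMap f)
    (ProjFG.toLinearMap g) hf
  exact ⟨ProjFG.ofLinearMap h, ProjFG.toLinearMap_injective hh⟩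

/-- The element of `F(Q)` corresponding to a morphism from the pro-object `F` to `Q`. -/
def elt {X : ProA R} {Q : ProjFG R} (x : X ⟶ (const R).obj Q) : X.unop.obj.obj Q :=
  x.unop.hom.app Q (𝟙 Q)

/-- Yoneda: such a morphism is a natural transformation out of Hom(Q, -), so the image of the
identity determines it. -/
theorem elt_injective {X : ProA R} {Q : ProjFG R} {x y : X ⟶ (const R).obj Q}
    (h : elt x = elt y) : x = y := by
  apply Quiver.Hom.unop_inj
  apply ObjectProperty.hom_ext
  ext T (g : Q ⟶ T)
  have key (z : X ⟶ (const R).obj Q) : z.unop.hom.app T g = X.unop.obj.map g (elt z) := by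
    refine Eq.trans ?_ (NatTrans.naturality_apply z.unop.hom g (𝟙 Q))
    exact congrArg (z.unop.hom.app T) (Category.id_comp g).symm
  rw [key, key, h]

theorem elt_comp_map {X : ProA R} {P Q : ProjFG R} (x : X ⟶ (const R).obj P) (g : P ⟶ Q) :
    elt (x ≫ (const R).map g) = x.unop.hom.app Q g :=
  congrArg (x.unop.hom.app Q) (Category.comp_id g)

theorem elt_comp {X Y : ProA R} {Q : ProjFG R} (f : X ⟶ Y) (y : Y ⟶ (const R).obj Q) :
    elt (f ≫ y) = f.unop.hom.app Q (elt y) := rfl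

/-- A presentation of a pro-object as the limit of a sequence of finitely generated projective
modules with surjective transition maps. -/
structure ProPresentation (X : ProA R) where
  /-- The modules of the sequence. -/
  P : ℕ → ProjFG R
  /-- The transition maps. -/
  t : ∀ n, P (n + 1) ⟶ P n
  /-- The projections. -/
  q : ∀ n, X ⟶ (const R).obj (P n)
  t_surjective : ∀ n, Function.Surjective (ProjFG.toLinearMap (t n))
  q_comp : ∀ n, q (n + 1) ≫ (const R).map (t n) = q n
  exists_elt : ∀ (Q : ProjFG R) (x : X.unop.obj.obj Q),
    ∃ (n : ℕ) (g : P n ⟶ Q), x = elt (q n ≫ (const R).map g)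
  cancel : ∀ (n : ℕ) (Q : ProjFG R) (g : P n ⟶ Q), q n ≫ (const R).map g = 0 → g = 0
  hom_ext : ∀ {Y : ProA R} {f g : Y ⟶ X}, (∀ n, f ≫ q n = g ≫ q n) → f = g
  exists_lift : ∀ {Y : ProA R} (y : ∀ n, Y ⟶ (const R).obj (P n)),
    (∀ n, y (n + 1) ≫ (const R).map (t n) = y n) → ∃ f : Y ⟶ X, ∀ n, f ≫ q n = y n

theorem exists_cofinal_sequence (I : Type u) [PartialOrder I] [IsDirectedOrder I] [Nonempty I]
    [Countable I] : ∃ s : ℕ → I, Monotone s ∧ ∀ i, ∃ n, i ≤ s n := by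
  obtain ⟨s, hs, ht⟩ := Filter.exists_seq_monotone_tendsto_atTop_atTop I
  exact ⟨s, hs, fun i => (ht.eventually_ge_atTop i).exists⟩

/-- The colimit of the functors Hom(Pᵢ, -) is computed objectwise, so each element comes from some
stage. Surjective transition maps make every Hom(Pᵢ, Q) inject into the colimit. The limit property
is the colimit property read in the opposite category. -/
theorem nonempty_proPresentation (X : ProA R) : Nonempty (ProPresentation X) := by
  obtain ⟨I, _, _, _, _, P, c₀, hP, ⟨hc₀⟩, ⟨e⟩⟩ := X.unop.property
  let c : Cocone (P.rightOp ⋙ preadditiveCoyoneda) := c₀.extend e.hom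
  have hc : IsColimit c := hc₀.extendIso e.hom
  let q (i : I) : X ⟶ (const R).obj (P.obj (op i)) :=
    Quiver.Hom.op (ObjectProperty.homMk (c.ι.app i))
  have hq {i j : I} (h : i ≤ j) : q j ≫ (const R).map (P.map (homOfLE h).op) = q i := by
    apply Quiver.Hom.unop_inj
    apply ObjectProperty.hom_ext
    exact c.w (homOfLE h)
  have hex (Q : ProjFG R) (x : X.unop.obj.obj Q) :
      ∃ (i : I) (g : P.obj (op i) ⟶ Q), x = elt (q i ≫ (const R).map g) := by
    obtain ⟨i, g, hg⟩ := Concrete.isColimit_exists_rep _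
      (isColimitOfPreserves ((evaluation _ _).obj Q) hc) x
    exact ⟨i, g, hg.symm.trans (elt_comp_map (q i) g).symm⟩
  have hcancel (i : I) (Q : ProjFG R) (g : P.obj (op i) ⟶ Q)
      (h : q i ≫ (const R).map g = 0) : g = 0 := by
    have h1 : (q i).unop.hom.app Q g = 0 := by rw [← elt_comp_map, h]; rfl
    have h2 : (q i).unop.hom.app Q (0 : P.obj (op i) ⟶ Q) = 0 :=
      map_zero ((q i).unop.hom.app Q).hom
    obtain ⟨j, f, f', hf⟩ := Concrete.isColimit_exists_of_rep_eq _
      (isColimitOfPreserves ((evaluation _ _).obj Q) hc) (i := i) (j := i) g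
      (0 : P.obj (op i) ⟶ Q) (h1.trans h2.symm)
    have hf' : P.map f.op ≫ g = P.map f'.op ≫ 0 := hf
    -- Arrows of a poset agree, so the equation says that `g` dies after composition with a
    -- surjective transition map.
    obtain rfl : f = f' := Subsingleton.elim _ _
    exact ProjFG.cancel_surjective (hP _) hf'
  have hext {Y : ProA R} {f g : Y ⟶ X} (h : ∀ i, f ≫ q i = g ≫ q i) : f = g := by
    apply Quiver.Hom.unop_inj
    apply ObjectProperty.hom_ext
    refine hc.hom_ext fun i => ?_
    exact congrArg (fun k : Y ⟶ (const R).obj (P.obj (op i)) => k.unop.hom) (h i)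
  have hlift {Y : ProA R} (y : ∀ i, Y ⟶ (const R).obj (P.obj (op i)))
      (hy : ∀ {i j : I} (h : i ≤ j), y j ≫ (const R).map (P.map (homOfLE h).op) = y i) :
      ∃ f : Y ⟶ X, ∀ i, f ≫ q i = y i := by
    let s : Cocone (P.rightOp ⋙ preadditiveCoyoneda) :=
      { pt := Y.unop.obj
        ι :=
          { app := fun i => (y i).unop.hom
            naturality := fun i j f =>
              (congrArg (fun k : Y ⟶ (const R).obj (P.obj (op i)) => k.unop.hom) (hy (leOfHom f))).trans
                (Category.comp_id _).symm } }
    refine ⟨Quiver.Hom.op (ObjectProperty.homMk (hc.desc s)), fun i => ?_⟩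
    apply Quiver.Hom.unop_inj
    apply ObjectProperty.hom_ext
    exact hc.fac s i
  obtain ⟨σ, hσ, hcof⟩ := exists_cofinal_sequence I
  have hPP {i j k : I} (h : i ≤ j) (h' : j ≤ k) : (const R).map (P.map (homOfLE h').op) ≫
      (const R).map (P.map (homOfLE h).op) = (const R).map (P.map (homOfLE (h.trans h')).op) := by
    rw [← Functor.map_comp, ← Functor.map_comp]
    rfl
  refine ⟨⟨fun n => P.obj (op (σ n)), fun n => P.map (homOfLE (hσ n.le_succ)).op,
    fun n => q (σ n), fun n => hP _, fun n => hq _, fun Q x => ?_, fun n Q g => hcancel _ Q g,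
    fun {Y f g} h => ?_, fun {Y} y hy => ?_⟩⟩
  · obtain ⟨i, g, hg⟩ := hex Q x
    obtain ⟨n, hn⟩ := hcof i
    exact ⟨n, P.map (homOfLE hn).op ≫ g, by rw [Functor.map_comp, ← Category.assoc, hq, hg]⟩
  · refine hext fun i => ?_
    obtain ⟨n, hn⟩ := hcof i
    rw [← hq hn, ← Category.assoc, h, Category.assoc]
  · have hy' {n m : ℕ} (h : n ≤ m) :
        y m ≫ (const R).map (P.map (homOfLE (hσ h)).op) = y n := by
      induction m, h using Nat.le_induction with
      | base =>
        rw [show (homOfLE (hσ le_rfl)).op = 𝟙 (op (σ n)) from rfl]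
        rw [CategoryTheory.Functor.map_id, CategoryTheory.Functor.map_id]
        exact Category.comp_id _
      | succ m h ih =>
        rw [← ih, ← hy m, Category.assoc, hPP (hσ h) (hσ m.le_succ)]
    -- The family is given only along `σ`. Its component at `i` is pushed down from the stage `N i`;
    -- `hz` shows that any other stage above `i` gives the same result.
    choose N hN using hcof
    have hz {i : I} {n : ℕ} (h : i ≤ σ n) : y n ≫ (const R).map (P.map (homOfLE h).op) =
        y (N i) ≫ (const R).map (P.map (homOfLE (hN i)).op) := by
      rw [← hy' (le_max_left n (N i)), ← hy' (le_max_right n (N i)), Category.assoc,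
        Category.assoc, hPP, hPP]
    obtain ⟨f, hf⟩ := hlift (fun i => y (N i) ≫ (const R).map (P.map (homOfLE (hN i)).op))
      (fun {i j} h => by rw [Category.assoc, hPP h (hN j), hz])
    refine ⟨f, fun n => ?_⟩
    rw [hf, ← hz le_rfl]
    exact hy' le_rfl

namespace ProPresentation

variable {X : ProA R} (p : ProPresentation X)

theorem exists_fac {Q : ProjFG R} (x : X ⟶ (const R).obj Q) :
    ∃ (n : ℕ) (g : p.P n ⟶ Q), x = p.q n ≫ (const R).map g := by
  obtain ⟨n, g, h⟩ := p.exists_elt Q (elt x)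
  exact ⟨n, g, elt_injective h⟩

/-- The transition maps of a presentation, for arbitrary indices. -/
theorem exists_trans {n m : ℕ} (h : n ≤ m) : ∃ g : p.P m ⟶ p.P n,
    p.q m ≫ (const R).map g = p.q n := by
  induction m, h using Nat.le_induction with
  | base => exact ⟨𝟙 _, by rw [CategoryTheory.Functor.map_id, Category.comp_id]⟩
  | succ m h ih =>
    obtain ⟨g, hg⟩ := ih
    exact ⟨p.t m ≫ g, by rw [Functor.map_comp, ← Category.assoc, p.q_comp, hg]⟩

theorem cancel' {n : ℕ} {Q : ProjFG R} {g h : p.P n ⟶ Q}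
    (e : p.q n ≫ (const R).map g = p.q n ≫ (const R).map h) : g = h := by
  rw [← sub_eq_zero]
  apply p.cancel
  rw [Functor.map_sub, Preadditive.comp_sub, e, sub_self]

end ProPresentation

theorem elt_surjective {X : ProA R} {Q : ProjFG R} (x : X.unop.obj.obj Q) :
    ∃ y : X ⟶ (const R).obj Q, elt y = x := by
  obtain ⟨p⟩ := nonempty_proPresentation X
  obtain ⟨n, g, h⟩ := p.exists_elt Q x
  exact ⟨_, h.symm⟩

theorem elt_const_map {P Q : ProjFG R} (f : P ⟶ Q) : elt ((const R).map f) = f :=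
  Category.comp_id f

instance : (const R).Faithful where
  map_injective {_ _ f g} h :=
    (elt_const_map f).symm.trans ((congrArg elt h).trans (elt_const_map g))

instance : (const R).Full where
  map_surjective x := ⟨elt x, elt_injective (elt_const_map (elt x))⟩

/-- A conflation whose cokernel is a finitely generated projective module splits. -/
theorem IsConflation.exists_splitting {X Y : ProA R} {P : ProjFG R} {f : X ⟶ Y}
    {q : Y ⟶ (const R).obj P} (h : IsConflation f q) :
    ∃ (r : Y ⟶ X) (s : (const R).obj P ⟶ Y), f ≫ r = 𝟙 X ∧ r ≫ f + q ≫ s = 𝟙 Y ∧ f ≫ q = 0 := by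
  obtain ⟨w, hw⟩ := h
  have hfq : f ≫ q = 0 := Quiver.Hom.unop_inj (ObjectProperty.hom_ext _ w)
  have hev (T : ProjFG R) := hw.map_of_exact ((evaluation (ProjFG R) AddCommGrpCat.{u}).obj T)
  have hsurj (T : ProjFG R) : Function.Surjective (f.unop.hom.app T) :=
    (AddCommGrpCat.epi_iff_surjective _).1 (hev T).epi_g
  have hinj (T : ProjFG R) : Function.Injective (q.unop.hom.app T) :=
    (AddCommGrpCat.mono_iff_injective _).1 (hev T).mono_f
  have hexact (T : ProjFG R) (x : Y.unop.obj.obj T) (hx : f.unop.hom.app T x = 0) :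
      ∃ g, q.unop.hom.app T g = x :=
    (ShortComplex.ab_exact_iff _).1 (hev T).exact x hx
  have extend {T : ProjFG R} (x : X ⟶ (const R).obj T) : ∃ y, f ≫ y = x := by
    obtain ⟨a, ha⟩ := hsurj T (elt x)
    obtain ⟨y, rfl⟩ := elt_surjective a
    exact ⟨y, elt_injective ha⟩
  have factor {T : ProjFG R} (y : Y ⟶ (const R).obj T) (hy : f ≫ y = 0) :
      ∃ g : P ⟶ T, y = q ≫ (const R).map g := by
    obtain ⟨g, hg⟩ := hexact T (elt y) (by rw [← elt_comp, hy]; rfl)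
    exact ⟨g, elt_injective (hg.symm.trans (elt_comp_map q g).symm)⟩
  have cancel {T : ProjFG R} {g g' : P ⟶ T}
      (e : q ≫ (const R).map g = q ≫ (const R).map g') : g = g' :=
    hinj T ((elt_comp_map q g).symm.trans ((congrArg elt e).trans (elt_comp_map q g')))
  obtain ⟨p⟩ := nonempty_proPresentation X
  obtain ⟨p'⟩ := nonempty_proPresentation Y
  -- Any extension `z` of the next projection fails to lift `y` by a map vanishing on X, hence by a
  -- map factoring through P. As P is projective, this error lifts through the transition map and
  -- can be subtracted.
  have step (n : ℕ) (y : Y ⟶ (const R).obj (p.P n)) (hy : f ≫ y = p.q n) :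
      ∃ y' : Y ⟶ (const R).obj (p.P (n + 1)), f ≫ y' = p.q (n + 1) ∧
        y' ≫ (const R).map (p.t n) = y := by
    obtain ⟨z, hz⟩ := extend (p.q (n + 1))
    obtain ⟨g, hg⟩ := factor (z ≫ (const R).map (p.t n) - y) (by
      rw [Preadditive.comp_sub, ← Category.assoc, hz, p.q_comp, hy, sub_self])
    obtain ⟨g', rfl⟩ := ProjFG.exists_lift (p.t_surjective n) g
    refine ⟨z - q ≫ (const R).map g', ?_, ?_⟩
    · rw [Preadditive.comp_sub, ← Category.assoc, hfq, zero_comp, sub_zero, hz]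
    · rw [Preadditive.sub_comp, Category.assoc, ← Functor.map_comp, ← hg, sub_sub_cancel]
  choose! next hnext₁ hnext₂ using step
  obtain ⟨y₀, hy₀⟩ := extend (p.q 0)
  let y : ∀ n, Y ⟶ (const R).obj (p.P n) := fun n => Nat.rec y₀ next n
  have hy : ∀ n, f ≫ y n = p.q n := by
    intro n
    induction n with
    | zero => exact hy₀
    | succ n ih => exact hnext₁ n _ ih
  obtain ⟨r, hr⟩ := p.exists_lift y fun n => hnext₂ n _ (hy n)
  have hfr : f ≫ r = 𝟙 X := p.hom_ext fun n => by
    rw [Category.assoc, hr, hy, Category.id_comp]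
  -- The idempotent complementary to `r ≫ f` vanishes on X, so it factors through P; uniqueness of
  -- the factors makes them compatible, and they assemble to a section of Y over P.
  have hs (n : ℕ) : ∃ g : P ⟶ p'.P n, (𝟙 Y - r ≫ f) ≫ p'.q n = q ≫ (const R).map g := by
    apply factor
    rw [← Category.assoc, Preadditive.comp_sub, ← Category.assoc, hfr, Category.id_comp,
      Category.comp_id, sub_self, zero_comp]
  choose g hg using hs
  obtain ⟨s, hs⟩ := p'.exists_lift (fun n => (const R).map (g n)) fun n => by
    rw [← Functor.map_comp]
    congr 1
    apply cancel
    rw [Functor.map_comp, ← Category.assoc, ← hg, ← hg, Category.assoc, p'.q_comp]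
  refine ⟨r, s, hfr, ?_, hfq⟩
  rw [← eq_sub_iff_add_eq']
  refine p'.hom_ext fun n => ?_
  rw [Category.assoc, hs, hg]

end ProObjects

/-! ### Elementary Tate objects as sequential unions -/

section TateObjects

variable {R : Type u} [CommRing R]

/-- The restriction of a section of a presheaf on pro-objects. -/
def restr (V : (ProA R)ᵒᵖ ⥤+ AddCommGrpCat.{u}) {X Y : ProA R} (g : Y ⟶ X) :
    V.obj.obj (op X) →+ V.obj.obj (op Y) :=
  (V.obj.map g.op).hom

variable (V W : (ProA R)ᵒᵖ ⥤+ AddCommGrpCat.{u}) {X Y Z : ProA R}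

theorem restr_comp (g : Y ⟶ X) (h : Z ⟶ Y) (v : V.obj.obj (op X)) :
    restr V (h ≫ g) v = restr V h (restr V g v) := by
  unfold restr
  rw [op_comp, Functor.map_comp]
  rfl

theorem restr_id (v : V.obj.obj (op X)) : restr V (𝟙 X) v = v := by
  unfold restr
  rw [op_id, CategoryTheory.Functor.map_id]
  rfl

theorem restr_add (g h : Y ⟶ X) (v : V.obj.obj (op X)) :
    restr V (g + h) v = restr V g v + restr V h v := by
  have : V.obj.map (g + h).op = V.obj.map g.op + V.obj.map h.op := by
    rw [op_add, Functor.map_add]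
  unfold restr
  rw [this]
  rfl

theorem restr_zero (v : V.obj.obj (op X)) : restr V (0 : Y ⟶ X) v = 0 := by
  have := restr_add V (0 : Y ⟶ X) 0 v
  rw [add_zero] at this
  exact left_eq_add.1 this

variable {V W}

theorem hom_app_restr (φ : V ⟶ W) (g : Y ⟶ X) (v : V.obj.obj (op X)) :
    φ.hom.app (op Y) (restr V g v) = restr W g (φ.hom.app (op X) v) :=
  NatTrans.naturality_apply φ.hom g.op v

/-- The morphism from a representable presheaf defined by a section. -/
def ofSection (w : W.obj.obj (op X)) : preadditiveYoneda.obj X ⟶ W.obj where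
  app Y := AddCommGrpCat.ofHom
    { toFun := fun g : Y.unop ⟶ X => restr W g w
      map_zero' := restr_zero W w
      map_add' := fun g h => restr_add W g h w }
  naturality Y Z h := by
    ext g
    exact restr_comp W g h.unop w

variable (V) in
/-- A presentation of a presheaf as the colimit of a sequence of pro-objects, along split
monomorphisms with finitely generated projective complement. -/
structure TatePresentation where
  /-- The pro-objects of the sequence. -/
  X : ℕ → ProA R
  /-- The transition maps. -/
  f : ∀ n, X n ⟶ X (n + 1)
  /-- The complements. -/
  P : ℕ → ProjFG R
  /-- The retractions. -/
  r : ∀ n, X (n + 1) ⟶ X n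
  /-- The projections to the complements. -/
  q : ∀ n, X (n + 1) ⟶ (const R).obj (P n)
  /-- The inclusions of the complements. -/
  s : ∀ n, (const R).obj (P n) ⟶ X (n + 1)
  f_r : ∀ n, f n ≫ r n = 𝟙 _
  f_q : ∀ n, f n ≫ q n = 0
  r_f_add : ∀ n, r n ≫ f n + q n ≫ s n = 𝟙 _
  /-- The canonical sections. -/
  v : ∀ n, V.obj.obj (op (X n))
  restr_v : ∀ n, restr V (f n) (v (n + 1)) = v n
  exists_restr : ∀ (Y : ProA R) (w : V.obj.obj (op Y)), ∃ (n : ℕ) (g : Y ⟶ X n), w = restr V g (v n)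
  cancel : ∀ (n : ℕ) (Y : ProA R) (g : Y ⟶ X n), restr V g (v n) = 0 → g = 0
  exists_desc : ∀ (W : (ProA R)ᵒᵖ ⥤+ AddCommGrpCat.{u}) (w : ∀ n, W.obj.obj (op (X n))),
    (∀ n, restr W (f n) (w (n + 1)) = w n) → ∃ φ : V ⟶ W, ∀ n, φ.hom.app _ (v n) = w n

/-- Restriction of the colimit to a cofinal sequence. The splittings supply the complements and also
make each step inject into the colimit. -/
theorem nonempty_tatePresentation (hV : isElementaryTate R V) : Nonempty (TatePresentation V) := by
  obtain ⟨I, _, _, _, _, X, c₀, hX, ⟨hc₀⟩, ⟨e⟩⟩ := hV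
  let c : Cocone (X ⋙ preadditiveYoneda) := c₀.extend e.hom
  have hc : IsColimit c := hc₀.extendIso e.hom
  let v (i : I) : V.obj.obj (op (X.obj i)) := (c.ι.app i).app (op (X.obj i)) (𝟙 (X.obj i))
  have hι {i : I} {Y : ProA R} (g : Y ⟶ X.obj i) : (c.ι.app i).app (op Y) g = restr V g (v i) := by
    refine Eq.trans ?_ (NatTrans.naturality_apply (c.ι.app i) g.op (𝟙 (X.obj i)))
    exact congrArg ((c.ι.app i).app (op Y)) (Category.comp_id g).symm
  have hv {i j : I} (h : i ≤ j) : restr V (X.map (homOfLE h)) (v j) = v i := by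
    have := congrArg (fun k : preadditiveYoneda.obj (X.obj i) ⟶ c.pt =>
      k.app (op (X.obj i)) (𝟙 (X.obj i))) (c.w (homOfLE h))
    rw [← hι]
    exact (congrArg ((c.ι.app j).app _) (Category.id_comp _).symm).trans this
  have hex (Y : ProA R) (w : V.obj.obj (op Y)) :
      ∃ (i : I) (g : Y ⟶ X.obj i), w = restr V g (v i) := by
    obtain ⟨i, g, hg⟩ := Concrete.isColimit_exists_rep _
      (isColimitOfPreserves ((evaluation _ _).obj (op Y)) hc) w
    exact ⟨i, g, hg.symm.trans (hι _)⟩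
  have hcancel (i : I) (Y : ProA R) (g : Y ⟶ X.obj i) (h : restr V g (v i) = 0) : g = 0 := by
    have h2 : (c.ι.app i).app (op Y) (0 : Y ⟶ X.obj i) = 0 := map_zero ((c.ι.app i).app (op Y)).hom
    obtain ⟨j, f, f', hf⟩ := Concrete.isColimit_exists_of_rep_eq _
      (isColimitOfPreserves ((evaluation _ _).obj (op Y)) hc) (i := i) (j := i) g
      (0 : Y ⟶ X.obj i) (((hι g).trans h).trans h2.symm)
    have hf' : g ≫ X.map f = 0 ≫ X.map f' := hf
    obtain ⟨P, q, hq⟩ := hX f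
    obtain ⟨r, -, hr, -⟩ := hq.exists_splitting
    rw [← Category.comp_id g, ← hr, ← Category.assoc, hf', zero_comp, zero_comp]
  have hdesc (W : (ProA R)ᵒᵖ ⥤+ AddCommGrpCat.{u}) (w : ∀ i, W.obj.obj (op (X.obj i)))
      (hw : ∀ {i j : I} (h : i ≤ j), restr W (X.map (homOfLE h)) (w j) = w i) :
      ∃ φ : V ⟶ W, ∀ i, φ.hom.app _ (v i) = w i := by
    let s : Cocone (X ⋙ preadditiveYoneda) :=
      { pt := W.obj
        ι :=
          { app := fun i => ofSection (w i)
            naturality := fun i j f => by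
              ext Y (g : Y.unop ⟶ X.obj i)
              refine (restr_comp W _ g (w j)).trans ?_
              exact congrArg (restr W g) (hw (leOfHom f)) } }
    refine ⟨ObjectProperty.homMk (hc.desc s), fun i => ?_⟩
    have := congrArg (fun k : preadditiveYoneda.obj (X.obj i) ⟶ W.obj =>
      k.app (op (X.obj i)) (𝟙 (X.obj i))) (hc.fac s i)
    exact this.trans (restr_id W (w i))
  obtain ⟨σ, hσ, hcof⟩ := exists_cofinal_sequence I
  choose P q hq using fun n : ℕ => hX (homOfLE (hσ n.le_succ))
  choose r s hr hrs hfq using fun n : ℕ => (hq n).exists_splitting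
  refine ⟨⟨fun n => X.obj (σ n), fun n => X.map (homOfLE (hσ n.le_succ)), P, r, q, s, hr, hfq, hrs,
    fun n => v (σ n), fun n => hv _, fun Y w => ?_, fun n => hcancel _, fun W w hw => ?_⟩⟩
  · obtain ⟨i, g, rfl⟩ := hex Y w
    obtain ⟨n, hn⟩ := hcof i
    exact ⟨n, g ≫ X.map (homOfLE hn), by rw [restr_comp, hv]⟩
  · have hXX {i j k : I} (h : i ≤ j) (h' : j ≤ k) (x : W.obj.obj (op (X.obj k))) :
        restr W (X.map (homOfLE h)) (restr W (X.map (homOfLE h')) x) =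
          restr W (X.map (homOfLE (h.trans h'))) x := by
      rw [← restr_comp, ← Functor.map_comp]
      rfl
    have hw' {n m : ℕ} (h : n ≤ m) : restr W (X.map (homOfLE (hσ h))) (w m) = w n := by
      induction m, h using Nat.le_induction with
      | base =>
        rw [show homOfLE (hσ le_rfl) = 𝟙 (σ n) from rfl, CategoryTheory.Functor.map_id]
        exact restr_id W _
      | succ m h ih => rw [← ih, ← hw m, hXX (hσ h) (hσ m.le_succ)]
    choose N hN using hcof
    have hz {i : I} {n : ℕ} (h : i ≤ σ n) : restr W (X.map (homOfLE h)) (w n) =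
        restr W (X.map (homOfLE (hN i))) (w (N i)) := by
      rw [← hw' (le_max_left n (N i)), ← hw' (le_max_right n (N i)), hXX, hXX]
    obtain ⟨φ, hφ⟩ := hdesc W (fun i => restr W (X.map (homOfLE (hN i))) (w (N i)))
      (fun {i j} h => by rw [hXX h (hN j), hz])
    refine ⟨φ, fun n => ?_⟩
    rw [hφ, ← hz le_rfl]
    exact hw' le_rfl

end TateObjects

/-! ### Realization of pro-objects: points, topology, full faithfulness -/

section ProPoints

variable {R : Type u} [CommRing R]

/-- The morphism from the free module of rank one defined by an element. -/
def ProjFG.ofElement {P : ProjFG R} (a : P.carrier) : ProjFG.unit R ⟶ P :=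
  ProjFG.ofLinearMap (LinearMap.toSpanSingleton R P.carrier a ∘ₗ
    LinearMap.proj (0 : Fin 1) ∘ₗ Submodule.subtype ⊤)

/-- The generator of the free module of rank one. -/
def ProjFG.unitGen : (ProjFG.unit R).carrier := ⟨fun _ => 1, trivial⟩

theorem ProjFG.ofElement_unitGen {P : ProjFG R} (a : P.carrier) :
    ProjFG.toLinearMap (ProjFG.ofElement a) ProjFG.unitGen = a :=
  one_smul R a

theorem ProjFG.ofElement_apply_unitGen {P : ProjFG R} (h : ProjFG.unit R ⟶ P) :
    ProjFG.ofElement (ProjFG.toLinearMap h ProjFG.unitGen) = h := by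
  apply ProjFG.toLinearMap_injective
  ext1 x
  let r : R := x.1 (0 : Fin 1)
  have hx : x = r • ProjFG.unitGen := by
    refine Subtype.ext (funext fun i : Fin 1 => ?_)
    rw [Subsingleton.elim i 0]
    exact (mul_one r).symm
  exact (map_smul (ProjFG.toLinearMap h) r ProjFG.unitGen).symm.trans
    (congrArg (ProjFG.toLinearMap h) hx.symm)

/-- The points of a finitely generated projective module. -/
def pointsConst (P : ProjFG R) : Points (yonedaPro.obj ((const R).obj P)) ≃ₗ[R] P.carrier where
  toFun x := ProjFG.toLinearMap (elt (Q := P) x) ProjFG.unitGen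
  map_add' _ _ := rfl
  map_smul' r x := map_smul (ProjFG.toLinearMap (elt (Q := P) x)) r ProjFG.unitGen
  invFun a := (const R).map (ProjFG.ofElement a)
  left_inv x := elt_injective ((elt_const_map _).trans (ProjFG.ofElement_apply_unitGen (elt x)))
  right_inv a := (congrArg (fun k : ProjFG.unit R ⟶ P => ProjFG.toLinearMap k ProjFG.unitGen)
    (elt_const_map (ProjFG.ofElement a))).trans (ProjFG.ofElement_unitGen a)

theorem pointsConst_map {P : ProjFG R} (h : ProjFG.unit R ⟶ P) :
    pointsConst P ((const R).map h) = ProjFG.toLinearMap h ProjFG.unitGen :=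
  congrArg (fun k : ProjFG.unit R ⟶ P => ProjFG.toLinearMap k ProjFG.unitGen) (elt_const_map h)

theorem pointsConst_comp {P Q : ProjFG R} (h : P ⟶ Q) (x : unitPro R ⟶ (const R).obj P) :
    pointsConst Q (x ≫ (const R).map h) = ProjFG.toLinearMap h (pointsConst P x) := by
  obtain ⟨g, rfl⟩ := (const R).map_surjective x
  rw [← Functor.map_comp]
  refine (pointsConst_map _).trans ?_
  exact congrArg (ProjFG.toLinearMap h) (pointsConst_map g).symm

theorem exists_map_of_linearMap {P Q : ProjFG R}
    (L : Points (yonedaPro.obj ((const R).obj P)) →ₗ[R] Points (yonedaPro.obj ((const R).obj Q))) :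
    ∃ h : P ⟶ Q, Points.map (yonedaPro.map ((const R).map h)) = L := by
  refine ⟨ProjFG.ofLinearMap ((pointsConst Q).toLinearMap ∘ₗ L ∘ₗ
    (pointsConst P).symm.toLinearMap), ?_⟩
  ext1 x
  apply (pointsConst Q).injective
  refine (pointsConst_comp _ x).trans ?_
  exact congrArg (pointsConst Q ∘ L) ((pointsConst P).symm_apply_apply x)

instance (P : ProjFG R) : Module.Finite R (Points (yonedaPro.obj ((const R).obj P))) :=
  have := P.finite
  Module.Finite.equiv (pointsConst P).symm

theorem const_map_eq_zero {P Q : ProjFG R} {h : P ⟶ Q}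
    (e : ∀ x : unitPro R ⟶ (const R).obj P, x ≫ (const R).map h = 0) : h = 0 := by
  apply ProjFG.toLinearMap_injective
  ext1 a
  have h1 := (congrArg (pointsConst Q) (e ((pointsConst P).symm a))).symm.trans
    (pointsConst_comp h ((pointsConst P).symm a))
  have h2 : pointsConst P ((pointsConst P).symm a) = a := (pointsConst P).apply_symm_apply a
  have h3 : pointsConst Q (0 : unitPro R ⟶ (const R).obj Q) = 0 := map_zero (pointsConst Q)
  exact (congrArg _ h2).symm.trans (h1.symm.trans h3)

namespace ProPresentation

variable {X Y : ProA R} (p : ProPresentation X)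

/-- A map to X needs components at all stages, while `z` starts at stage `n`. The component at stage
`m` is `z m` pushed from `P (n + m)` down to `P m`. -/
theorem exists_lift_above (n : ℕ) (z : ∀ k, Y ⟶ (const R).obj (p.P (n + k)))
    (hz : ∀ k, z (k + 1) ≫ (const R).map (p.t (n + k)) = z k) :
    ∃ f : Y ⟶ X, f ≫ p.q n = z 0 := by
  choose g hg using fun m : ℕ => p.exists_trans (Nat.le_add_left m n)
  obtain ⟨f, hf⟩ := p.exists_lift (fun m => z m ≫ (const R).map (g m)) fun m => by
    rw [← hz m, Category.assoc, Category.assoc, ← Functor.map_comp, ← Functor.map_comp]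
    congr 2
    apply p.cancel'
    rw [Functor.map_comp, Functor.map_comp, ← Category.assoc, ← Category.assoc, hg, p.q_comp]
    exact (hg m).symm.trans (congrArg (· ≫ (const R).map (g m)) (p.q_comp (n + m)).symm)
  refine ⟨f, ?_⟩
  -- At stage `n` the construction gives `z n` pushed from `P (n + n)` to `P n`; the induction
  -- identifies it with `z 0`.
  have key (k : ℕ) (h : p.P (n + k) ⟶ p.P n) (hh : p.q (n + k) ≫ (const R).map h = p.q n) :
      z k ≫ (const R).map h = z 0 := by
    induction k with
    | zero =>
      have : h = 𝟙 _ := p.cancel' (hh.trans (by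
        rw [CategoryTheory.Functor.map_id]; exact (Category.comp_id _).symm))
      rw [this, CategoryTheory.Functor.map_id]
      exact Category.comp_id _
    | succ k ih =>
      obtain ⟨h₀, hh₀⟩ := p.exists_trans (Nat.le_add_right n k)
      have : h = p.t (n + k) ≫ h₀ := p.cancel' (hh.trans (by
        rw [Functor.map_comp, ← Category.assoc]
        exact hh₀.symm.trans (congrArg (· ≫ (const R).map h₀) (p.q_comp (n + k)).symm)))
      rw [this, Functor.map_comp, ← Category.assoc, hz, ih h₀ hh₀]
  rw [hf]
  exact key n (g n) (hg n)

/-- The projections are surjective on points. -/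
theorem exists_comp_q (n : ℕ) (x : unitPro R ⟶ (const R).obj (p.P n)) :
    ∃ y : unitPro R ⟶ X, y ≫ p.q n = x := by
  have step (k : ℕ) (z : unitPro R ⟶ (const R).obj (p.P (n + k))) :
      ∃ z' : unitPro R ⟶ (const R).obj (p.P (n + (k + 1))),
        z' ≫ (const R).map (p.t (n + k)) = z := by
    obtain ⟨g, rfl⟩ := (const R).map_surjective z
    obtain ⟨h, rfl⟩ := ProjFG.exists_lift (p.t_surjective (n + k)) g
    exact ⟨(const R).map h, ((const R).map_comp _ _).symm⟩
  choose next hnext using step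
  exact p.exists_lift_above n (fun k => Nat.rec x next k) fun k => hnext k _

theorem proj_surjective (n : ℕ) : Function.Surjective (proj (p.q n)) := p.exists_comp_q n

theorem ker_proj_antitone : Antitone fun n => LinearMap.ker (proj (p.q n)) := by
  intro n m h x hx
  obtain ⟨g, hg⟩ := p.exists_trans h
  have hx' : (show unitPro R ⟶ X from x) ≫ p.q m = 0 := hx
  change (show unitPro R ⟶ X from x) ≫ p.q n = 0
  rw [← hg, ← Category.assoc, hx', zero_comp]

/-- Every map to a finitely generated projective module factors through a stage, and finitely many
stages are dominated by one, so the decreasing kernels of the stage projections form a basis. -/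
theorem mem_proOpens_iff {U : Submodule R (Points (yonedaPro.obj X))} :
    U ∈ (proOpens X).sets ↔ ∃ n, LinearMap.ker (proj (p.q n)) ≤ U := by
  constructor
  · rintro ⟨s, hs, hU⟩
    have h1 (q : Σ P : ProjFG R, X ⟶ (const R).obj P) :
        ∃ n, LinearMap.ker (proj (p.q n)) ≤ LinearMap.ker (proj q.2) := by
      obtain ⟨n, g, hg⟩ := p.exists_fac q.2
      refine ⟨n, fun x hx => ?_⟩
      have hx' : (show unitPro R ⟶ X from x) ≫ p.q n = 0 := hx
      change (show unitPro R ⟶ X from x) ≫ q.2 = 0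
      rw [hg, ← Category.assoc, hx', zero_comp]
    choose N hN using h1
    obtain ⟨n, hn⟩ := (hs.image N).bddAbove
    refine ⟨n, le_trans (le_iInf₂ fun q hq => ?_) hU⟩
    exact (p.ker_proj_antitone (hn (Set.mem_image_of_mem N hq))).trans (hN q)
  · rintro ⟨n, hn⟩
    exact ⟨{⟨_, p.q n⟩}, Set.finite_singleton _, by rwa [iInf_singleton]⟩

end ProPresentation

theorem ker_proj_mem_proOpens {X : ProA R} {P : ProjFG R} (q : X ⟶ (const R).obj P) :
    LinearMap.ker (proj q) ∈ (proOpens X).sets :=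
  ⟨{⟨_, q⟩}, Set.finite_singleton _, by rw [iInf_singleton]⟩

theorem mem_proOpens_of_le {X : ProA R} {U W : Submodule R (Points (yonedaPro.obj X))}
    (hU : U ∈ (proOpens X).sets) (h : U ≤ W) : W ∈ (proOpens X).sets := by
  obtain ⟨s, hs, hU⟩ := hU
  exact ⟨s, hs, hU.trans h⟩

theorem comap_mem_proOpens {X Y : ProA R} (g : X ⟶ Y)
    {U : Submodule R (Points (yonedaPro.obj Y))} (hU : U ∈ (proOpens Y).sets) :
    U.comap (Points.map (yonedaPro.map g)) ∈ (proOpens X).sets := by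
  obtain ⟨p⟩ := nonempty_proPresentation Y
  obtain ⟨n, hn⟩ := p.mem_proOpens_iff.1 hU
  refine mem_proOpens_of_le (ker_proj_mem_proOpens (g ≫ p.q n)) fun x hx => hn ?_
  exact (Category.assoc (show unitPro R ⟶ X from x) g (p.q n)).trans hx

/-- A morphism of pro-objects is determined by its values on points. -/
theorem eq_of_comp_eq {X Y : ProA R} {g h : X ⟶ Y} (e : ∀ x : unitPro R ⟶ X, x ≫ g = x ≫ h) :
    g = h := by
  obtain ⟨p⟩ := nonempty_proPresentation X
  obtain ⟨p'⟩ := nonempty_proPresentation Y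
  refine p'.hom_ext fun n => ?_
  rw [← sub_eq_zero, ← Preadditive.sub_comp]
  -- The difference, composed to a stage of Y, factors through a stage of X, all of whose points
  -- lift to points of X.
  obtain ⟨m, k, hk⟩ := p.exists_fac ((g - h) ≫ p'.q n)
  rw [hk, const_map_eq_zero (h := k), Functor.map_zero, comp_zero]
  intro x
  obtain ⟨y, rfl⟩ := p.exists_comp_q m x
  rw [Category.assoc, ← hk, ← Category.assoc, Preadditive.comp_sub, e, sub_self, zero_comp]

/-- Continuous linear maps between realizations of pro-objects come from morphisms. -/
theorem exists_hom_of_continuous {X Y : ProA R}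
    (G : Points (yonedaPro.obj X) →ₗ[R] Points (yonedaPro.obj Y))
    (hG : ∀ U ∈ (proOpens Y).sets, U.comap G ∈ (proOpens X).sets) :
    ∃ g : X ⟶ Y, Points.map (yonedaPro.map g) = G := by
  obtain ⟨p⟩ := nonempty_proPresentation X
  obtain ⟨p'⟩ := nonempty_proPresentation Y
  have h1 (j : ℕ) : ∃ y : X ⟶ (const R).obj (p'.P j), ∀ x : unitPro R ⟶ X,
      x ≫ y = (show unitPro R ⟶ Y from G x) ≫ p'.q j := by
    -- The composite with the projection to the discrete stage `j` has open kernel, so it descends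
    -- to the quotient `p.P n` of the points of X.
    obtain ⟨n, hn⟩ := p.mem_proOpens_iff.1 (hG _ (ker_proj_mem_proOpens (p'.q j)))
    let e := (proj (p.q n)).quotKerEquivOfSurjective (p.proj_surjective n)
    let L := (LinearMap.ker (proj (p.q n))).liftQ (proj (p'.q j) ∘ₗ G) hn ∘ₗ e.symm.toLinearMap
    obtain ⟨h, hh⟩ := exists_map_of_linearMap L
    refine ⟨p.q n ≫ (const R).map h, fun (x : Points (yonedaPro.obj X)) => ?_⟩
    refine (Category.assoc (show unitPro R ⟶ X from x) _ _).symm.trans ?_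
    refine (LinearMap.congr_fun hh (proj (p.q n) x)).trans ?_
    have hx : e.symm (proj (p.q n) x) = (LinearMap.ker (proj (p.q n))).mkQ x :=
      e.symm_apply_apply ((LinearMap.ker (proj (p.q n))).mkQ x)
    exact congrArg ((LinearMap.ker (proj (p.q n))).liftQ (proj (p'.q j) ∘ₗ G) hn) hx
  choose y hy using h1
  obtain ⟨g, hg⟩ := p'.exists_lift y fun j => eq_of_comp_eq fun x => by
    rw [← Category.assoc, hy, hy, Category.assoc, p'.q_comp]
  refine ⟨g, LinearMap.ext fun x => p'.hom_ext fun j => ?_⟩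
  refine Eq.trans ?_ (hy j x)
  exact (Category.assoc (show unitPro R ⟶ X from x) g (p'.q j)).trans (congrArg _ (hg j))

end ProPoints

/-! ### Realization of Tate objects: open submodules, full faithfulness, completeness -/

section TatePoints

variable {R : Type u} [CommRing R] {V W : (ProA R)ᵒᵖ ⥤+ AddCommGrpCat.{u}} {X Y : ProA R}

theorem pullLinear_restr (g : Y ⟶ X) (v : V.obj.obj (op X)) :
    pullLinear V (restr V g v) = pullLinear V v ∘ₗ Points.map (yonedaPro.map g) :=
  LinearMap.ext fun x => (restr_comp V g x v).symm

theorem points_map_pullLinear (φ : V ⟶ W) (v : V.obj.obj (op X)) :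
    Points.map φ ∘ₗ pullLinear V v = pullLinear W (φ.hom.app (op X) v) :=
  LinearMap.ext fun x => hom_app_restr φ x v

theorem points_map_comp {V' : (ProA R)ᵒᵖ ⥤+ AddCommGrpCat.{u}} (φ : V ⟶ W) (ψ : W ⟶ V') :
    Points.map (φ ≫ ψ) = Points.map ψ ∘ₗ Points.map φ := rfl

theorem points_map_id : Points.map (𝟙 V) = LinearMap.id := rfl

theorem mem_tateOpens_of_le {U U' : Submodule R (Points V)} (hU : U ∈ (tateOpens V).sets)
    (h : U ≤ U') : U' ∈ (tateOpens V).sets :=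
  fun X v => mem_proOpens_of_le (hU X v) (Submodule.comap_mono h)

namespace TatePresentation

variable (p : TatePresentation V)

theorem hom_ext {φ ψ : V ⟶ W} (h : ∀ n, φ.hom.app _ (p.v n) = ψ.hom.app _ (p.v n)) : φ = ψ := by
  apply ObjectProperty.hom_ext
  ext Y w
  obtain ⟨n, g, rfl⟩ := p.exists_restr Y.unop w
  exact (hom_app_restr φ g _).trans ((congrArg _ (h n)).trans (hom_app_restr ψ g _).symm)

theorem pullLinear_injective (n : ℕ) : Function.Injective (pullLinear V (p.v n)) := by
  rw [← LinearMap.ker_eq_bot, LinearMap.ker_eq_bot']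
  exact fun x hx => p.cancel n _ x hx

theorem exists_pullLinear (x : Points V) :
    ∃ (n : ℕ) (y : Points (yonedaPro.obj (p.X n))), pullLinear V (p.v n) y = x := by
  obtain ⟨n, g, hg⟩ := p.exists_restr _ x
  exact ⟨n, g, hg.symm⟩

theorem exists_trans {n m : ℕ} (h : n ≤ m) : ∃ g : p.X n ⟶ p.X m, restr V g (p.v m) = p.v n := by
  induction m, h using Nat.le_induction with
  | base => exact ⟨𝟙 _, restr_id V _⟩
  | succ m h ih =>
    obtain ⟨g, hg⟩ := ih
    exact ⟨g ≫ p.f m, by rw [restr_comp, p.restr_v, hg]⟩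

theorem range_pullLinear_mono : Monotone fun n => LinearMap.range (pullLinear V (p.v n)) := by
  rintro n m h _ ⟨x, rfl⟩
  obtain ⟨g, hg⟩ := p.exists_trans h
  rw [← hg, pullLinear_restr]
  exact ⟨_, rfl⟩

/-- In Xₙ₊₁ = Xₙ ⊕ Pₙ the summand Xₙ is the kernel of the projection to the discrete Pₙ, hence open.
Openness of a submodule of V(R) therefore propagates from X₀ to every step. -/
theorem mem_tateOpens_iff {U : Submodule R (Points V)} :
    U ∈ (tateOpens V).sets ↔ U.comap (pullLinear V (p.v 0)) ∈ (proOpens (p.X 0)).sets := by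
  refine ⟨fun h => h _ _, fun h => ?_⟩
  have h' (n : ℕ) : U.comap (pullLinear V (p.v n)) ∈ (proOpens (p.X n)).sets := by
    induction n with
    | zero => exact h
    | succ n ih =>
      obtain ⟨π⟩ := nonempty_proPresentation (p.X n)
      obtain ⟨m, hm⟩ := π.mem_proOpens_iff.1 ih
      refine mem_proOpens_of_le ((proOpens _).inf_mem _ (ker_proj_mem_proOpens (p.r n ≫ π.q m)) _
        (ker_proj_mem_proOpens (p.q n))) ?_
      rintro (x : unitPro R ⟶ _) ⟨hx₁, hx₂⟩
      have hx₁' : (x ≫ p.r n) ≫ π.q m = 0 := (Category.assoc _ _ _).trans hx₁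
      have hx₂' : x ≫ p.q n = 0 := hx₂
      have hx : x = (x ≫ p.r n) ≫ p.f n := by
        have := congrArg (fun k => x ≫ k) (p.r_f_add n)
        simp only [Preadditive.comp_add, ← Category.assoc, hx₂', zero_comp, add_zero] at this
        rw [this, Category.comp_id]
      have h1 := hm (show _ from hx₁')
      change restr V (x ≫ p.r n) (p.v n) ∈ U at h1
      change restr V x (p.v (n + 1)) ∈ U
      rwa [hx, restr_comp, p.restr_v]
  intro X v
  obtain ⟨n, g, rfl⟩ := p.exists_restr X v
  rw [pullLinear_restr, Submodule.comap_comp]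
  exact comap_mem_proOpens g (h' n)

/-- With `pullLinear_injective`, this makes each step an open submodule of V(R) carrying its own
topology. -/
theorem map_mem_tateOpens (n : ℕ) {U : Submodule R (Points (yonedaPro.obj (p.X n)))}
    (hU : U ∈ (proOpens (p.X n)).sets) : U.map (pullLinear V (p.v n)) ∈ (tateOpens V).sets := by
  rw [p.mem_tateOpens_iff]
  obtain ⟨g, hg⟩ := p.exists_trans n.zero_le
  refine mem_proOpens_of_le (comap_mem_proOpens g hU) fun x hx => ?_
  rw [Submodule.mem_comap, ← hg, pullLinear_restr]
  exact ⟨_, hx, rfl⟩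

/-- A section over a pro-object is determined by its realization. -/
theorem eq_of_pullLinear_eq (p : TatePresentation V) {w w' : V.obj.obj (op X)} (h : pullLinear V w = pullLinear V w') :
    w = w' := by
  obtain ⟨n, g, hg⟩ := p.exists_restr X (w - w')
  rw [← sub_eq_zero, hg]
  have hg0 : g = 0 := eq_of_comp_eq fun x => by
    rw [comp_zero]
    apply p.cancel n
    rw [restr_comp, ← hg, map_sub, sub_eq_zero]
    exact LinearMap.congr_fun h x
  rw [hg0, restr_zero]

/-- Continuous linear maps from the realization of a pro-object come from sections. -/
theorem exists_pullLinear_eq (p : TatePresentation V)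
    (F : Points (yonedaPro.obj X) →ₗ[R] Points V)
    (hF : ∀ U ∈ (tateOpens V).sets, U.comap F ∈ (proOpens X).sets) :
    ∃ w : V.obj.obj (op X), pullLinear V w = F := by
  obtain ⟨π⟩ := nonempty_proPresentation X
  let N (k : ℕ) : Submodule R (Points V) := LinearMap.range (pullLinear V (p.v k))
  have hN0 : N 0 ∈ (tateOpens V).sets := by
    have := p.map_mem_tateOpens 0 (proOpens (p.X 0)).top_mem
    rwa [Submodule.map_top] at this
  -- Since X₀ is open, `F` carries the kernel of a stage projection into it; only the finitely
  -- generated quotient `π.P m` remains to be controlled.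
  obtain ⟨m, hm⟩ := π.mem_proOpens_iff.1 (hF _ hN0)
  obtain ⟨S, hS⟩ := Module.Finite.fg_top (R := R)
    (M := Points (yonedaPro.obj ((const R).obj (π.P m))))
  choose x hx using π.proj_surjective m
  choose K y hy using p.exists_pullLinear
  -- A step containing the images of lifts of all generators of `π.P m`. It also contains X₀, so it
  -- contains the image of `F`.
  let k := S.sup fun a => K (F (x a))
  have htop : (⊤ : Submodule R _) ≤ ((N k).comap F).map (proj (π.q m)) := by
    rw [← hS, Submodule.span_le]
    intro a ha
    refine ⟨x a, ?_, hx a⟩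
    exact p.range_pullLinear_mono (Finset.le_sup (f := fun a => K (F (x a))) ha) ⟨_, hy _⟩
  have hFN (z) : F z ∈ N k := by
    obtain ⟨z', hz', hzz⟩ := htop (x := proj (π.q m) z) trivial
    have h1 : z - z' ∈ LinearMap.ker (proj (π.q m)) := by
      rw [LinearMap.mem_ker, map_sub, hzz, sub_self]
    have h2 : F (z - z') ∈ N k := p.range_pullLinear_mono k.zero_le (hm h1)
    rw [map_sub] at h2
    exact (Submodule.sub_mem_iff_left (N k) (show F z' ∈ N k from hz')).1 h2
  let G : Points (yonedaPro.obj X) →ₗ[R] Points (yonedaPro.obj (p.X k)) :=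
    (LinearEquiv.ofInjective _ (p.pullLinear_injective k)).symm.toLinearMap ∘ₗ F.codRestrict _ hFN
  have hG (z) : pullLinear V (p.v k) (G z) = F z :=
    congrArg Subtype.val ((LinearEquiv.ofInjective _ (p.pullLinear_injective k)).apply_symm_apply
      (F.codRestrict _ hFN z))
  -- Open submodules of the step `p.X k` stay open in V(R), so `G` inherits continuity from `F`.
  obtain ⟨g, hg⟩ := exists_hom_of_continuous G fun U hU => by
    refine mem_proOpens_of_le (hF _ (p.map_mem_tateOpens k hU)) ?_
    rintro z ⟨u, hu, huz⟩
    rw [← hG] at huz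
    rwa [Submodule.mem_comap, ← p.pullLinear_injective k huz]
  refine ⟨restr V g (p.v k), ?_⟩
  rw [pullLinear_restr, hg]
  exact LinearMap.ext hG

end TatePresentation

theorem retractClosure_isElementaryTate (hV : (isElementaryTate R).retractClosure V) :
    ∃ (V' : (ProA R)ᵒᵖ ⥤+ AddCommGrpCat.{u}) (_ : TatePresentation V') (i : V ⟶ V') (r : V' ⟶ V),
      i ≫ r = 𝟙 V := by
  obtain ⟨V', hV', ⟨ρ⟩⟩ := hV
  obtain ⟨p⟩ := nonempty_tatePresentation hV'
  exact ⟨V', p, ρ.i, ρ.r, ρ.retract⟩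

theorem points_map_injective (hV : (isElementaryTate R).retractClosure V)
    (hW : (isElementaryTate R).retractClosure W) {φ ψ : V ⟶ W}
    (h : Points.map φ = Points.map ψ) : φ = ψ := by
  obtain ⟨V', p, i, r, hir⟩ := retractClosure_isElementaryTate hV
  obtain ⟨W', p', i', r', hir'⟩ := retractClosure_isElementaryTate hW
  have key : r ≫ φ ≫ i' = r ≫ ψ ≫ i' := p.hom_ext fun n => p'.eq_of_pullLinear_eq <| by
    rw [← points_map_pullLinear, ← points_map_pullLinear, points_map_comp, points_map_comp, h]
    rfl
  have := congrArg (fun k => i ≫ k ≫ r') key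
  simp only [Category.assoc, hir', Category.comp_id] at this
  simpa only [← Category.assoc, hir, Category.id_comp] using this

/-- The retractions reduce to a map between elementary objects. On each step it is given by a
section, which is unique by `eq_of_pullLinear_eq`; so these sections are compatible and glue to a
morphism. -/
theorem exists_points_map_eq (hV : (isElementaryTate R).retractClosure V)
    (hW : (isElementaryTate R).retractClosure W) (F : Points V →ₗ[R] Points W)
    (hF : ∀ U ∈ (tateOpens W).sets, U.comap F ∈ (tateOpens V).sets) :
    ∃ φ : V ⟶ W, Points.map φ = F := by
  obtain ⟨V', p, i, r, hir⟩ := retractClosure_isElementaryTate hV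
  obtain ⟨W', p', i', r', hir'⟩ := retractClosure_isElementaryTate hW
  let F' : Points V' →ₗ[R] Points W' := Points.map i' ∘ₗ F ∘ₗ Points.map r
  have hF' (U) (hU : U ∈ (tateOpens W').sets) : U.comap F' ∈ (tateOpens V').sets :=
    comap_map_mem_tateOpens r _ (hF _ (comap_map_mem_tateOpens i' U hU))
  choose w hw using fun n => p'.exists_pullLinear_eq (F' ∘ₗ pullLinear V' (p.v n))
    fun U hU => hF' U hU _ _
  obtain ⟨φ, hφ⟩ := p.exists_desc W' w fun n => p'.eq_of_pullLinear_eq <| by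
    rw [pullLinear_restr, hw, hw, LinearMap.comp_assoc, ← pullLinear_restr, p.restr_v]
  have hφF : Points.map φ = F' := by
    ext1 x
    obtain ⟨n, y, rfl⟩ := p.exists_pullLinear x
    have := points_map_pullLinear φ (p.v n)
    rw [hφ, hw] at this
    exact LinearMap.congr_fun this y
  refine ⟨i ≫ φ ≫ r', ?_⟩
  rw [points_map_comp, points_map_comp, hφF]
  change (Points.map r' ∘ₗ Points.map i') ∘ₗ F ∘ₗ (Points.map r ∘ₗ Points.map i) = F
  rw [← points_map_comp, ← points_map_comp, hir, hir', points_map_id, points_map_id]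
  rfl

/-- The realization of an elementary Tate object has a countable basis of open submodules, is
separated and complete. -/
theorem TatePresentation.exists_basis (p : TatePresentation V) :
    ∃ U : ℕ → Submodule R (Points V), (∀ n, U n ∈ (tateOpens V).sets) ∧ Antitone U ∧
      (∀ W ∈ (tateOpens V).sets, ∃ n, U n ≤ W) ∧ (∀ x, (∀ n, x ∈ U n) → x = 0) ∧
      ∀ x : ℕ → Points V, (∀ n, x (n + 1) - x n ∈ U n) → ∃ y, ∀ n, y - x n ∈ U n := by
  obtain ⟨π⟩ := nonempty_proPresentation (p.X 0)
  refine ⟨fun n => (LinearMap.ker (proj (π.q n))).map (pullLinear V (p.v 0)),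
    fun n => p.map_mem_tateOpens 0 (ker_proj_mem_proOpens _),
    fun n m h => Submodule.map_mono (π.ker_proj_antitone h), fun W hW => ?_, fun x hx => ?_,
    fun x hx => ?_⟩
  · obtain ⟨n, hn⟩ := π.mem_proOpens_iff.1 (hW _ (p.v 0))
    exact ⟨n, Submodule.map_le_iff_le_comap.2 hn⟩
  · obtain ⟨y, -, rfl⟩ := hx 0
    have hy : y = 0 := by
      refine π.hom_ext (f := y) (g := 0) fun n => ?_
      obtain ⟨y', hy', h⟩ := hx n
      rw [p.pullLinear_injective 0 h] at hy'
      exact (show _ = _ from hy').trans zero_comp.symm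
    rw [hy, map_zero]
  · have h0 (n : ℕ) : ∃ z, pullLinear V (p.v 0) z = x n - x 0 := by
      induction n with
      | zero => exact ⟨0, by rw [map_zero, sub_self]⟩
      | succ n ih =>
        obtain ⟨z, hz⟩ := ih
        obtain ⟨z', -, hz'⟩ := hx n
        exact ⟨z' + z, by rw [map_add, hz, hz', sub_add_sub_cancel]⟩
    choose z hz using h0
    have hzn (n : ℕ) : z (n + 1) - z n ∈ LinearMap.ker (proj (π.q n)) := by
      obtain ⟨z', hz', h⟩ := hx n
      have : pullLinear V (p.v 0) z' = pullLinear V (p.v 0) (z (n + 1) - z n) := by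
        rw [h, map_sub, hz, hz, sub_sub_sub_cancel_right]
      rwa [← p.pullLinear_injective 0 this]
    have hzn' (n : ℕ) : proj (π.q n) (z (n + 1)) = proj (π.q n) (z n) := by
      have := hzn n
      rwa [LinearMap.mem_ker, map_sub, sub_eq_zero] at this
    -- The `n`-th coordinate no longer changes from the term `z n` on, so it is the `n`-th
    -- coordinate of the limit.
    obtain ⟨y, hy⟩ := π.exists_lift (fun n => proj (π.q n) (z n)) fun n => by
      refine Eq.trans ?_ (hzn' n)
      exact (Category.assoc (show unitPro R ⟶ _ from z (n + 1)) _ _).trans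
        (congrArg _ (π.q_comp n))
    refine ⟨pullLinear V (p.v 0) y + x 0, fun n => ⟨(show Points (yonedaPro.obj _) from y) - z n,
      ?_, ?_⟩⟩
    · refine LinearMap.mem_ker.2 ?_
      rw [map_sub, sub_eq_zero]
      exact hy n
    · rw [map_sub, hz]
      abel

end TatePoints

/-! ### The realization is compactly generated, weakly Hausdorff and fully faithful -/

section Topology

variable {R : Type u} [CommRing R]

/-- The basis is pulled back along the inclusion `i` into an elementary object. It is a basis
because an open W is the preimage under `i` of the open submodule r⁻¹(W). -/
theorem exists_basis_of_retractClosure {V : (ProA R)ᵒᵖ ⥤+ AddCommGrpCat.{u}}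
    (hV : (isElementaryTate R).retractClosure V) :
    ∃ U : ℕ → Submodule R (Points V), (∀ n, U n ∈ (tateOpens V).sets) ∧
      (∀ W ∈ (tateOpens V).sets, ∃ n, U n ≤ W) ∧ ∀ x, (∀ n, x ∈ U n) → x = 0 := by
  obtain ⟨V', p, i, r, hir⟩ := retractClosure_isElementaryTate hV
  obtain ⟨U, hU, -, hbasis, hsep, -⟩ := p.exists_basis
  have hr (x : Points V) : Points.map r (Points.map i x) = x := by
    refine Eq.trans ?_ (LinearMap.congr_fun points_map_id x)
    rw [← hir]
    rfl
  refine ⟨fun n => (U n).comap (Points.map i), fun n => comap_map_mem_tateOpens i _ (hU n),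
    fun W hW => ?_, fun x hx => ?_⟩
  · obtain ⟨n, hn⟩ := hbasis _ (comap_map_mem_tateOpens r W hW)
    refine ⟨n, fun x hx => ?_⟩
    have := hn hx
    rwa [Submodule.mem_comap, hr] at this
  · rw [← hr x, hsep _ hx, map_zero]

variable [TopologicalSpace R]

/-- A separated linearly topologized module with a countable basis of open submodules is compactly
generated and weakly Hausdorff. -/
theorem isCGWH_of_countable_basis (M : TopMod R) (U : ℕ → Submodule R M.obj)
    (hU : (nhds (0 : M.obj)).HasBasis (fun _ => True) (fun n => (U n : Set M.obj)))
    (h0 : ∀ x, (∀ n, x ∈ U n) → x = 0) : isCGWH R M := by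
  have h1 : (nhds (0 : M.obj)).IsCountablyGenerated := hU.isCountablyGenerated
  have h2 : FirstCountableTopology M.obj := ⟨fun a => by
    rw [← map_add_left_nhds_zero a]
    infer_instance⟩
  have h3 : T2Space M.obj := IsTopologicalAddGroup.t2Space_of_zero_sep fun x hx => by
    by_contra! h
    exact hx (h0 x fun n => h _ (hU.mem_of_mem trivial))
  exact ⟨inferInstance, fun K f => (isCompact_range f.continuous).isClosed⟩

variable [DiscreteTopology R]

theorem isCGWH_realization (V : Tate R) : isCGWH R ((realization R).obj V) := by
  obtain ⟨U, hU, hbasis, hsep⟩ := exists_basis_of_retractClosure V.property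
  refine isCGWH_of_countable_basis _ U ⟨fun t => ?_⟩ hsep
  refine (tateOpens V.obj).hasBasis.mem_iff.trans ⟨?_, ?_⟩
  · rintro ⟨W, hW, hWt⟩
    obtain ⟨n, hn⟩ := hbasis W hW
    exact ⟨n, trivial, fun x hx => hWt (hn hx)⟩
  · rintro ⟨n, -, hn⟩
    exact ⟨U n, hU n, hn⟩

instance : (realization R).Faithful where
  map_injective {V W φ ψ} h := by
    apply ObjectProperty.hom_ext
    refine points_map_injective V.property W.property (LinearMap.ext fun x => ?_)
    exact congrArg (fun k : (realization R).obj V ⟶ (realization R).obj W => k.hom.hom x) h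

instance : (realization R).Full where
  map_surjective {V W} F := by
    let L : Points V.obj →ₗ[R] Points W.obj := F.hom.hom.toLinearMap
    obtain ⟨φ, hφ⟩ := exists_points_map_eq V.property W.property L fun U hU => by
      have h0 : Filter.Tendsto F.hom.hom (nhds 0) (nhds (F.hom.hom 0)) :=
        F.hom.hom.continuous.tendsto 0
      rw [map_zero] at h0
      obtain ⟨U', hU', h⟩ := ((tateOpens V.obj).hasBasis.tendsto_iff (tateOpens W.obj).hasBasis).1
        h0 U hU
      exact mem_tateOpens_of_le hU' h
    refine ⟨ObjectProperty.homMk φ, ?_⟩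
    apply ObjectProperty.hom_ext
    ext x
    exact LinearMap.congr_fun hφ x

end Topology

/-! ### Full faithfulness of C⁰(-, M) -/

section ContinuousMaps

variable {R : Type u} [CommRing R] [TopologicalSpace R]

/-- The points of a morphism of sheaves of continuous maps. -/
def onPoints {M N : TopModuleCat.{u} R} (ψ : contSheaf.obj M ⟶ contSheaf.obj N) : M →ₗ[R] N where
  toFun m := (show C(Profinite.of PUnit.{u + 1}, N) from
    ψ.hom.app (op (Profinite.of PUnit.{u + 1})) (ContinuousMap.const _ m)) PUnit.unit
  map_add' m n := by
    have := map_add (ψ.hom.app (op (Profinite.of PUnit.{u + 1}))).hom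
      (ContinuousMap.const (Profinite.of PUnit.{u + 1}) m)
      (ContinuousMap.const (Profinite.of PUnit.{u + 1}) n)
    exact congrArg (fun k : C(Profinite.of PUnit.{u + 1}, N) => k PUnit.unit) this
  map_smul' r m := by
    have := map_smul (ψ.hom.app (op (Profinite.of PUnit.{u + 1}))).hom r
      (ContinuousMap.const (Profinite.of PUnit.{u + 1}) m)
    exact congrArg (fun k : C(Profinite.of PUnit.{u + 1}, N) => k PUnit.unit) this

/-- Naturality along the inclusion of the point `t`. Hence a morphism is composition with its map on
points. -/
theorem onPoints_apply {M N : TopModuleCat.{u} R} (ψ : contSheaf.obj M ⟶ contSheaf.obj N)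
    (T : Profinite.{u}) (f : C(T, M)) (t : T) :
    (show C(T, N) from ψ.hom.app (op T) f) t = onPoints ψ (f t) := by
  let c : Profinite.of PUnit.{u + 1} ⟶ T :=
    CompHausLike.ofHom _ (ContinuousMap.const _ t)
  have := NatTrans.naturality_apply ψ.hom c.op f
  exact (congrArg (fun k : C(Profinite.of PUnit.{u + 1}, N) => k PUnit.unit) this).symm

/-- Maps out of a compactly generated space that are continuous on profinite sets are
continuous. -/
theorem continuous_of_profinite {X Y : Type u} [TopologicalSpace X] [TopologicalSpace Y]
    [CompactlyGeneratedSpace X] (f : X → Y)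
    (h : ∀ (T : Profinite.{u}) (g : C(T, X)), Continuous (f ∘ g)) : Continuous f := by
  refine continuous_from_uCompactlyGeneratedSpace f fun K g => ?_
  let π : C(K.presentation, K) := (CompHaus.presentation.π K).hom.hom
  have hπ : Function.Surjective π := (CompHaus.epi_iff_surjective _).1 inferInstance
  have hq : Topology.IsQuotientMap π := .of_surjective_continuous hπ π.continuous
  rw [hq.continuous_iff]
  exact h (Stonean.toProfinite.obj K.presentation) (g.comp π)

theorem underline_map_injective {M N : TopMod R} {φ ψ : M ⟶ N}
    (h : (underline R).map φ = (underline R).map ψ) : φ = ψ := by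
  apply ObjectProperty.hom_ext
  ext x
  exact congrArg (fun k : (underline R).obj M ⟶ (underline R).obj N =>
    (show C(Profinite.of PUnit.{u + 1}, N.obj) from
      k.hom.app (op (Profinite.of PUnit.{u + 1})) (ContinuousMap.const _ x)) PUnit.unit) h

/-- Applied to a continuous map from a profinite set, `ψ` returns a continuous map, so `onPoints ψ`
is continuous on profinite tests; compact generation of M does the rest. -/
theorem exists_underline_map_eq {M N : TopMod R} (hM : CompactlyGeneratedSpace M.obj)
    (ψ : (underline R).obj M ⟶ (underline R).obj N) : ∃ φ, (underline R).map φ = ψ := by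
  have hc : Continuous (onPoints ψ) := by
    have : CompactlyGeneratedSpace ((isLinTop R).ι.obj M) := hM
    refine continuous_of_profinite _ fun T g => ?_
    have e : onPoints ψ ∘ g = (show C(T, N.obj) from ψ.hom.app (op T) g) :=
      funext fun t => (onPoints_apply ψ T g t).symm
    rw [e]
    exact (show C(T, N.obj) from ψ.hom.app (op T) g).continuous
  refine ⟨ObjectProperty.homMk (TopModuleCat.ofHom ⟨onPoints ψ, hc⟩), ?_⟩
  apply ObjectProperty.hom_ext
  ext T f
  refine ContinuousMap.ext fun t => ?_
  exact (onPoints_apply ψ T.unop f t).symm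

end ContinuousMaps

/-! ### Separation for linear topologies -/

section LinearTopology

variable {R : Type u} [CommRing R]

/-- Points are images of the one-point space, hence closed, and a topological group with closed
points is Hausdorff. -/
theorem WeaklyHausdorff.t2Space {M : Type u} [TopologicalSpace M] [AddCommGroup M]
    [IsTopologicalAddGroup M] (h : WeaklyHausdorff M) : T2Space M := by
  refine IsTopologicalAddGroup.t2Space_of_zero_sep fun x hx => ⟨{x}ᶜ, ?_, by simp⟩
  have := h (CompHaus.of PUnit.{u + 1}) (ContinuousMap.const _ x)
  rw [show Set.range (ContinuousMap.const (CompHaus.of PUnit.{u + 1}) x) = {x} by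
    ext y; simp [eq_comm]] at this
  exact this.isOpen_compl.mem_nhds (Ne.symm hx)

theorem totallyDisconnectedSpace_of_isLinearTopology (M : Type u) [TopologicalSpace M]
    [AddCommGroup M] [Module R M] [IsTopologicalAddGroup M] [IsLinearTopology R M] [T2Space M] :
    TotallyDisconnectedSpace M := by
  have : NonarchimedeanAddGroup M := ⟨fun U hU => by
    obtain ⟨N, hN, hNU⟩ := (IsLinearTopology.hasBasis_open_submodule R).mem_iff.1 hU
    exact ⟨⟨N.toAddSubgroup, hN⟩, hNU⟩⟩
  infer_instance

end LinearTopology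

/-! ### C⁰(-, M) is left Kan extended from small profinite sets -/

instance compactSpace_range {X Y : Type u} [TopologicalSpace X] [CompactSpace X]
    [TopologicalSpace Y] (f : C(X, Y)) : CompactSpace (Set.range f) :=
  isCompact_iff_compactSpace.1 (isCompact_range f.continuous)

/-- The image of a profinite set, as a profinite set. -/
def rangeProfinite {T : Profinite.{u}} {Y : Type u} [TopologicalSpace Y] [T2Space Y]
    [TotallyDisconnectedSpace Y] (f : C(T, Y)) : Profinite.{u} :=
  Profinite.of (Set.range f)

section Range

variable {T : Profinite.{u}} {Y : Type u} [TopologicalSpace Y] [T2Space Y]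
    [TotallyDisconnectedSpace Y] (f : C(T, Y))

/-- The projection of a profinite set to its image. -/
def toRangeProfinite : T ⟶ rangeProfinite f :=
  CompHausLike.ofHom _ ⟨Set.rangeFactorization f, f.continuous.subtype_mk _⟩

/-- The inclusion of the image. -/
def rangeProfiniteVal : C(rangeProfinite f, Y) := ⟨Subtype.val, continuous_subtype_val⟩

theorem isSmallProfinite_range {κ : Cardinal.{u}} (h : Cardinal.mk Y < κ) :
    isSmallProfinite κ (rangeProfinite f) :=
  (Cardinal.mk_set_le (Set.range f)).trans_lt h

end Range

section KanExtension

variable {R : Type u} [CommRing R] [TopologicalSpace R] {M : TopModuleCat.{u} R}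
  {κ : Cardinal.{u}} {T : Profinite.{u}}

/-- A map to a small profinite set, as an object of the category indexing the left Kan
extension. -/
def smallQuotient {S : Profinite.{u}} (hS : isSmallProfinite κ S) (π : T ⟶ S) :
    CostructuredArrow (isSmallProfinite κ).ι.op (op T) :=
  CostructuredArrow.mk (S := (isSmallProfinite κ).ι.op)
    (Y := op (⟨S, hS⟩ : (isSmallProfinite κ).FullSubcategory)) (show op S ⟶ op T from π.op)

variable (s : Cocone (CostructuredArrow.proj (isSmallProfinite κ).ι.op (op T) ⋙
  (isSmallProfinite κ).ι.op ⋙ (contSheaf.obj M).obj))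

/-- The component of a cocone at a map to a small profinite set. -/
def legAt {S : Profinite.{u}} (hS : isSmallProfinite κ S) (π : T ⟶ S) : C(S, M) →ₗ[R] s.pt :=
  (s.ι.app (smallQuotient hS π)).hom

theorem legAt_comp {S S' : Profinite.{u}} (hS : isSmallProfinite κ S)
    (hS' : isSmallProfinite κ S') (π : T ⟶ S) (π' : T ⟶ S') (e : S' ⟶ S) (h : π' ≫ e = π)
    (f : C(S, M)) : legAt s hS π f = legAt s hS' π' (f.comp e.hom.hom) := by
  let m : smallQuotient hS π ⟶ smallQuotient hS' π' :=
    CostructuredArrow.homMk (Quiver.Hom.op (ObjectProperty.homMk e)) (congrArg Quiver.Hom.op h)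
  exact (congrArg (fun k : ModuleCat.of R C(S, M) ⟶ s.pt => k.hom f) (s.w m)).symm

variable [T2Space M] [TotallyDisconnectedSpace M]

/-- The leg depends only on the composite map to M. The image of `π` is a small profinite set that
includes into `S` and maps by `f` onto the image of the composite; the cocone relations along these
two maps compare the sides. -/
theorem legAt_eq_range (hM : Cardinal.mk M < κ) {S : Profinite.{u}} (hS : isSmallProfinite κ S)
    (π : T ⟶ S) (f : C(S, M)) (g : C(T, M)) (hg : f.comp π.hom.hom = g) :
    legAt s hS π f =
      legAt s (isSmallProfinite_range g hM) (toRangeProfinite g) (rangeProfiniteVal g) := by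
  subst hg
  have hS' : isSmallProfinite κ (rangeProfinite π.hom.hom) := isSmallProfinite_range _ hS
  let i : rangeProfinite π.hom.hom ⟶ S := CompHausLike.ofHom _ (rangeProfiniteVal π.hom.hom)
  have hr (x : Set.range π.hom.hom) : f x.1 ∈ Set.range (f.comp π.hom.hom) := by
    obtain ⟨_, t, rfl⟩ := x
    exact ⟨t, rfl⟩
  let r : rangeProfinite π.hom.hom ⟶ rangeProfinite (f.comp π.hom.hom) :=
    CompHausLike.ofHom _ ⟨fun x => ⟨f x.1, hr x⟩,
      (f.continuous.comp continuous_subtype_val).subtype_mk hr⟩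
  exact (legAt_comp s hS hS' π (toRangeProfinite π.hom.hom) i rfl f).trans
    (legAt_comp s (isSmallProfinite_range _ hM) hS' (toRangeProfinite (f.comp π.hom.hom))
      (toRangeProfinite π.hom.hom) r rfl (rangeProfiniteVal (f.comp π.hom.hom))).symm

variable (hM' : Cardinal.mk M < κ) (hM : Cardinal.mk (M × M) < κ)

/-- The map out of `C(T, M)` induced by a cocone. -/
def descLinear : C(T, M) →ₗ[R] s.pt where
  toFun g := legAt s (isSmallProfinite_range g hM') (toRangeProfinite g) (rangeProfiniteVal g)
  map_add' f g := by
    -- The maps `f`, `g` and `f + g` all factor through the image of the pair, where the leg is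
    -- additive. This is why the size of M × M must be bounded.
    let k : C(T, M × M) := f.prodMk g
    have hk := isSmallProfinite_range k hM
    let a : C(rangeProfinite k, M) := (ContinuousMap.fst).comp (rangeProfiniteVal k)
    let b : C(rangeProfinite k, M) := (ContinuousMap.snd).comp (rangeProfiniteVal k)
    rw [← legAt_eq_range s hM' hk (toRangeProfinite k) a f rfl,
      ← legAt_eq_range s hM' hk (toRangeProfinite k) b g rfl,
      ← legAt_eq_range s hM' hk (toRangeProfinite k) (a + b) (f + g) rfl, map_add]
  map_smul' r g := by
    rw [← legAt_eq_range s hM' (isSmallProfinite_range g hM') (toRangeProfinite g)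
      (r • rangeProfiniteVal g) (r • g) rfl, map_smul]
    rfl

end KanExtension

/-- Beth numbers at limit ordinals are strong limits; adding ω to an ordinal produces a limit
ordinal beyond it. -/
theorem exists_isStrongLimit_gt (c : Cardinal.{u}) :
    ∃ κ : Cardinal.{u}, c < κ ∧ Cardinal.aleph0 < κ ∧ κ.IsStrongLimit := by
  have h (d : Cardinal.{u}) (hd : d ≤ max c Cardinal.aleph0) :
      d < Cardinal.beth ((max c Cardinal.aleph0).ord + Ordinal.omega0) :=
    (hd.trans (Cardinal.le_beth_ord _)).trans_lt
      (Cardinal.beth_strictMono (lt_add_of_pos_right _ Ordinal.omega0_pos))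
  exact ⟨_, h _ (le_max_left _ _), h _ (le_max_right _ _), Cardinal.isStrongLimit_beth.2
    (Ordinal.isSuccLimit_add _ Ordinal.isSuccLimit_omega0).isSuccPrelimit⟩

/-- The extension is pointwise: a map T → M factors through its image, which is profinite as M is
Hausdorff and totally disconnected, and has fewer than κ elements. So C(T, M) is the colimit over
maps from T to small profinite sets. -/
theorem isCondensed_contSheaf {R : Type u} [CommRing R] [TopologicalSpace R]
    (M : TopModuleCat.{u} R) [T2Space M] [TotallyDisconnectedSpace M] :
    isCondensed R (contSheaf.obj M) := by
  obtain ⟨κ, hκ, hκ₀, hκ'⟩ := exists_isStrongLimit_gt (max (Cardinal.mk M) (Cardinal.mk (M × M)))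
  have hM := (le_max_right _ _).trans_lt hκ
  have hM' := (le_max_left _ _).trans_lt hκ
  refine ⟨κ, hκ₀, hκ', ?_⟩
  let E : (isSmallProfinite κ).ι.op.LeftExtension
      ((isSmallProfinite κ).ι.op ⋙ (contSheaf.obj M).obj) := .mk _ (𝟙 _)
  have hE : E.IsPointwiseLeftKanExtension := fun Y =>
    { desc := fun s => ModuleCat.ofHom (descLinear (T := Y.unop) s hM' hM)
      fac := fun s j => by
        ext f
        exact (legAt_eq_range s hM' j.left.unop.property j.hom.unop f _ rfl).symm
      uniq := fun s m hm => by
        ext g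
        exact congrArg (fun k : ModuleCat.of R C(rangeProfinite g, M) ⟶ s.pt =>
          k.hom (rangeProfiniteVal g))
          (hm (smallQuotient (isSmallProfinite_range g hM') (toRangeProfinite g))) }
  exact hE.isLeftKanExtension

theorem isCondensed_underline {R : Type u} [CommRing R] [TopologicalSpace R] (M : TopMod R)
    (hM : WeaklyHausdorff M.obj) : isCondensed R ((underline R).obj M) := by
  have h2 : T2Space M.obj := hM.t2Space
  have : IsLinearTopology R M.obj := M.property
  have := totallyDisconnectedSpace_of_isLinearTopology (R := R) M.obj
  exact isCondensed_contSheaf M.obj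

/-! ### Measures on a profinite set and Riemann sums -/

section Measures

variable {R : Type u} [CommRing R] {S : Profinite.{u}}

/-- A section of the projection to a finite quotient. -/
noncomputable def quotSection (i : DiscreteQuotient S) : i → S := Function.surjInv i.proj_surjective

theorem proj_quotSection (i : DiscreteQuotient S) (a : i) : i.proj (quotSection i a) = a :=
  Function.surjInv_eq i.proj_surjective a

/-- The Riemann sum of a function with respect to a measure, for a finite quotient. -/
noncomputable def riemannSum {M : Type*} [AddCommMonoid M] [Module R M] (f : S → M)
    (i : DiscreteQuotient S) : limFree R S →ₗ[R] M :=
  Finsupp.linearCombination R (f ∘ quotSection i) ∘ₗ limFreeProj R S i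

theorem map_riemannSum {M M' : Type*} [AddCommMonoid M] [Module R M] [AddCommMonoid M']
    [Module R M'] (L : M →ₗ[R] M') (f : S → M)
    (i : DiscreteQuotient S) (μ : limFree R S) :
    L (riemannSum f i μ) = riemannSum (L ∘ f) i μ :=
  Finsupp.apply_linearCombination R L _ _

variable {M : Type*} [AddCommGroup M] [Module R M]

/-- A function is constant on the fibres of a finite quotient, up to elements of a submodule. -/
def FiberConst (f : S → M) (N : Submodule R M) (i : DiscreteQuotient S) : Prop :=
  ∀ s s', i.proj s = i.proj s' → f s - f s' ∈ N

theorem FiberConst.of_le {f : S → M} {N : Submodule R M} {i j : DiscreteQuotient S}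
    (h : FiberConst f N j) (hij : i ≤ j) : FiberConst f N i := fun s s' hs => h s s' <| by
  rw [← DiscreteQuotient.ofLE_proj hij, ← DiscreteQuotient.ofLE_proj hij, hs]

theorem exists_fiberConst (f : S → M) (N : Submodule R M)
    (h : ∀ s, IsOpen {s' | f s - f s' ∈ N}) : ∃ i : DiscreteQuotient S, FiberConst f N i := by
  let i : DiscreteQuotient S :=
    { r := fun s s' => f s - f s' ∈ N
      iseqv :=
        { refl := fun s => by rw [sub_self]; exact N.zero_mem
          symm := fun {s s'} hs => by rw [← neg_sub]; exact N.neg_mem hs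
          trans := fun {s s' s''} h₁ h₂ => by
            rw [← sub_add_sub_cancel (f s) (f s')]; exact N.add_mem h₁ h₂ }
      isOpen_setOfPred_rel := h }
  exact ⟨i, fun s s' hs => Quotient.exact hs⟩

/-- The weight of a class of `j` is the sum of the weights of the classes of `i` inside it. The two
sums thus differ only in sample points, taken in the same class of `j`. -/
theorem riemannSum_sub_mem {f : S → M} {N : Submodule R M} {i j : DiscreteQuotient S}
    (h : FiberConst f N j) (hij : i ≤ j) (μ : limFree R S) :
    riemannSum f i μ - riemannSum f j μ ∈ N := by
  have hμ : limFreeProj R S j μ = Finsupp.mapDomain (DiscreteQuotient.ofLE hij)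
    (limFreeProj R S i μ) := (μ.2 i j hij).symm
  change Finsupp.linearCombination R _ _ - Finsupp.linearCombination R _ _ ∈ N
  rw [hμ, Finsupp.linearCombination_mapDomain, Finsupp.linearCombination_apply,
    Finsupp.linearCombination_apply, ← Finsupp.sum_sub]
  refine N.sum_mem fun a _ => ?_
  dsimp only
  rw [← smul_sub]
  refine N.smul_mem _ (h _ _ ?_)
  rw [proj_quotSection, ← DiscreteQuotient.ofLE_proj hij, proj_quotSection]

theorem riemannSum_sub_mem' {f : S → M} {N : Submodule R M} {i j : DiscreteQuotient S}
    (hi : FiberConst f N i) (hj : FiberConst f N j) (μ : limFree R S) :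
    riemannSum f i μ - riemannSum f j μ ∈ N := by
  rw [← sub_sub_sub_cancel_left _ _ (riemannSum f (i ⊓ j) μ)]
  exact N.sub_mem (riemannSum_sub_mem hj inf_le_right μ) (riemannSum_sub_mem hi inf_le_left μ)

theorem riemannSum_eq {f : S → M} {i j : DiscreteQuotient S}
    (hi : FiberConst f (⊥ : Submodule R M) i) (hj : FiberConst f (⊥ : Submodule R M) j)
    (μ : limFree R S) : riemannSum f i μ = riemannSum f j μ :=
  sub_eq_zero.1 ((Submodule.mem_bot R).1 (riemannSum_sub_mem' hi hj μ))

/-- The Dirac measure at a point, as an element of the module `limFree`. -/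
noncomputable def diracMeasure (s : S) : limFree R S :=
  ⟨fun i => Finsupp.single (i.proj s) 1, fun i j h => by
    rw [Finsupp.mapDomain_single, DiscreteQuotient.ofLE_proj]⟩

theorem riemannSum_dirac {M : Type*} [AddCommMonoid M] [Module R M]
    (f : S → M) (i : DiscreteQuotient S) (s : S) :
    riemannSum f i (diracMeasure s : limFree R S) = f (quotSection i (i.proj s)) := by
  refine (Finsupp.linearCombination_single R (1 : R) (i.proj s)).trans ?_
  exact one_smul R _

/-- A measure may be replaced by a finite combination of Dirac measures without changing its sums at
a given level. This is how finitely many coordinates are matched in the uniqueness argument. -/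
theorem riemannSum_riemannSum_dirac {M : Type*} [AddCommMonoid M] [Module R M]
    (f : S → M) (i : DiscreteQuotient S) (μ : limFree R S) :
    riemannSum f i (riemannSum (diracMeasure (R := R)) i μ) = riemannSum f i μ := by
  refine (map_riemannSum (riemannSum f i) (diracMeasure (R := R)) i μ).trans ?_
  change Finsupp.linearCombination R _ _ = Finsupp.linearCombination R _ _
  congr 2
  funext a
  change riemannSum f i (diracMeasure (R := R) (quotSection i a)) = f (quotSection i a)
  rw [riemannSum_dirac, proj_quotSection]

/-! ### Measures as functionals on locally constant functions -/

variable (R) in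
/-- A locally constant integral function, with values in `R`. -/
def castFun (h : LocallyConstant S ℤ) : S → R := fun s => (h s : R)

theorem exists_fiberConst_castFun (h : LocallyConstant S ℤ) :
    ∃ i : DiscreteQuotient S, FiberConst (castFun R h) (⊥ : Submodule R R) i := by
  exact exists_fiberConst _ _ fun s => h.isLocallyConstant {z : ℤ | (h s : R) - (z : R) ∈ (⊥ : Submodule R R)}

/-- The integral of locally constant functions with respect to a measure. -/
noncomputable def pairing (μ : limFree R S) : LocallyConstant S ℤ →ₗ[ℤ] R :=
  AddMonoidHom.toIntLinearMap <| AddMonoidHom.mk'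
    (fun h => riemannSum (castFun R h) (exists_fiberConst_castFun h).choose μ) fun h h' => by
      -- Additivity is clear at a common level adapted to both functions, and `riemannSum_eq` makes
      -- the chosen levels irrelevant.
      obtain ⟨i, hi⟩ := exists_fiberConst_castFun (R := R) h
      obtain ⟨j, hj⟩ := exists_fiberConst_castFun (R := R) h'
      have e : castFun R (h + h') = castFun R h + castFun R h' :=
        funext fun s => Int.cast_add (h s) (h' s)
      have hk : FiberConst (castFun R (h + h')) (⊥ : Submodule R R) (i ⊓ j) := fun s s' hs => by
        rw [e, Pi.add_apply, Pi.add_apply, add_sub_add_comm]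
        exact Submodule.add_mem _ (hi.of_le inf_le_left s s' hs) (hj.of_le inf_le_right s s' hs)
      rw [riemannSum_eq (exists_fiberConst_castFun (h + h')).choose_spec hk,
        riemannSum_eq (exists_fiberConst_castFun h).choose_spec (hi.of_le (inf_le_left (b := j))),
        riemannSum_eq (exists_fiberConst_castFun h').choose_spec (hj.of_le (inf_le_right (a := i))), e]
      change Finsupp.linearCombination R _ _ = Finsupp.linearCombination R _ _ +
        Finsupp.linearCombination R _ _
      simp only [Finsupp.linearCombination_apply, Function.comp_apply, Pi.add_apply, smul_add,
        Finsupp.sum_add]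

theorem pairing_eq {h : LocallyConstant S ℤ} {i : DiscreteQuotient S}
    (hi : FiberConst (castFun R h) (⊥ : Submodule R R) i) (μ : limFree R S) :
    pairing μ h = riemannSum (castFun R h) i μ :=
  riemannSum_eq (exists_fiberConst_castFun h).choose_spec hi μ

open Classical in
/-- The indicator function of a fibre of a finite quotient. -/
noncomputable def fiberFun (i : DiscreteQuotient S) (a : i) : LocallyConstant S ℤ :=
  ⟨fun s => if i.proj s = a then 1 else 0,
    i.proj_isLocallyConstant.comp fun b => if b = a then 1 else 0⟩

open Classical in
theorem fiberFun_apply (i : DiscreteQuotient S) (a : i) (s : S) :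
    fiberFun i a s = if i.proj s = a then 1 else 0 := rfl

open Classical in
/-- The measure defined by a functional on locally constant functions. -/
noncomputable def ofFunctional : (LocallyConstant S ℤ →ₗ[ℤ] R) →ₗ[R] limFree R S where
  toFun ℓ := ⟨fun i => Finsupp.equivFunOnFinite.symm fun a => ℓ (fiberFun i a), fun i j h => by
    ext b
    have := Fintype.ofFinite i
    rw [Finsupp.mapDomain, Finsupp.sum_fintype _ _ fun _ => Finsupp.single_zero _,
      Finsupp.finsetSum_apply]
    simp only [Finsupp.single_apply, Finsupp.equivFunOnFinite_symm_apply_apply]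
    -- A fibre of the coarser quotient is the disjoint union of the fibres of the finer one above
    -- it.
    have e : fiberFun j b =
        ∑ a : i, if DiscreteQuotient.ofLE h a = b then fiberFun i a else 0 := by
      ext s
      rw [← LocallyConstant.coeFnAddMonoidHom_apply, ← LocallyConstant.coeFnAddMonoidHom_apply,
        map_sum, Finset.sum_apply, Finset.sum_eq_single (i.proj s)]
      · rw [DiscreteQuotient.ofLE_proj]
        split_ifs with hs
        · simp [fiberFun_apply, hs]
        · simp [fiberFun_apply, hs]
      · intro a _ ha
        split_ifs
        · simp [fiberFun_apply, ha.symm]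
        · simp
      · simp
    rw [e, map_sum]
    refine Finset.sum_congr rfl fun a _ => ?_
    split_ifs
    · rfl
    · rw [map_zero]⟩
  map_add' ℓ ℓ' := by
    refine Subtype.ext (funext fun i => Finsupp.ext fun a => rfl)
  map_smul' r ℓ := by
    refine Subtype.ext (funext fun i => Finsupp.ext fun a => rfl)

theorem ofFunctional_apply (ℓ : LocallyConstant S ℤ →ₗ[ℤ] R) (i : DiscreteQuotient S) (a : i) :
    limFreeProj R S i (ofFunctional ℓ) a = ℓ (fiberFun i a) := rfl

/-- The integral of the indicator of a class is the coefficient at that class, so a measure is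
determined by its integrals. -/
theorem ofFunctional_pairing (μ : limFree R S) : ofFunctional (pairing μ) = μ := by
  classical
  refine Subtype.ext (funext fun i => Finsupp.ext fun a => ?_)
  have hi : FiberConst (castFun R (fiberFun i a)) (⊥ : Submodule R R) i := fun s s' hs => by
    rw [Submodule.mem_bot, castFun, castFun, fiberFun_apply, fiberFun_apply, hs, sub_self]
  refine (pairing_eq hi μ).trans ?_
  have e : castFun R (fiberFun i a) ∘ quotSection i = fun b => if b = a then 1 else 0 := by
    funext b
    rw [Function.comp_apply, castFun, fiberFun_apply, proj_quotSection]
    split_ifs <;> simp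
  change Finsupp.linearCombination R _ (μ.1 i) = μ.1 i a
  rw [e, Finsupp.linearCombination_apply]
  simp [Finsupp.sum, eq_comm]

variable (R S) in
/-- The measures whose coefficients belong to a finitely generated subring. -/
def boundedMeasures : Submodule R (limFree R S) where
  carrier := {μ | ∃ A : Set R, A.Finite ∧
    ∀ (i : DiscreteQuotient S) (a : i), limFreeProj R S i μ a ∈ Subring.closure A}
  add_mem' := by
    rintro f g ⟨A, hA, hf⟩ ⟨B, hB, hg⟩
    exact ⟨A ∪ B, hA.union hB, fun i a =>
      add_mem (Subring.closure_mono Set.subset_union_left (hf i a))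
        (Subring.closure_mono Set.subset_union_right (hg i a))⟩
  zero_mem' := ⟨∅, Set.finite_empty, fun i a => zero_mem _⟩
  smul_mem' := by
    rintro r f ⟨A, hA, hf⟩
    exact ⟨insert r A, hA.insert r, fun i a =>
      mul_mem (Subring.subset_closure (Set.mem_insert r A))
        (Subring.closure_mono (Set.subset_insert r A) (hf i a))⟩

variable (R) in
/-- The Dirac measure at a point, as a bounded measure. -/
noncomputable def boundedDirac (s : S) : boundedMeasures R S :=
  ⟨diracMeasure s, ∅, Set.finite_empty, fun i a => by
    change Finsupp.single (i.proj s) (1 : R) a ∈ _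
    classical
    rw [Finsupp.single_apply]
    split_ifs
    · exact one_mem _
    · exact zero_mem _⟩

theorem exists_closure_pairing_mem {μ : limFree R S} (hμ : μ ∈ boundedMeasures R S) :
    ∃ A : Set R, A.Finite ∧ ∀ h, pairing μ h ∈ Subring.closure A := by
  obtain ⟨A, hA, hμ⟩ := hμ
  refine ⟨A, hA, fun h => ?_⟩
  refine (Subring.closure A).sum_mem fun a _ => ?_
  exact mul_mem (hμ _ a) (intCast_mem _ _)

/-- Coefficients are integrals of indicators, hence integral combinations of the coordinates in the
basis. So any family with values in a subring is the coordinate family of a measure over that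
subring. -/
theorem ofFunctional_mem {A : Set R} {ℓ : LocallyConstant S ℤ →ₗ[ℤ] R}
    {I : Type*} (b : Module.Basis I ℤ (LocallyConstant S ℤ))
    (h : ∀ k, ℓ (b k) ∈ Subring.closure A) (i : DiscreteQuotient S) (a : i) :
    limFreeProj R S i (ofFunctional ℓ) a ∈ Subring.closure A := by
  rw [ofFunctional_apply, ← b.linearCombination_repr (fiberFun i a), Finsupp.apply_linearCombination,
    Finsupp.linearCombination_apply]
  exact (Subring.closure A).sum_mem fun k _ => zsmul_mem (h k) _

end Measures

/-! ### Morphisms from bounded measures are determined by Dirac measures -/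

section Uniqueness

variable {R : Type u} [CommRing R] {S : Profinite.{u}}

open Classical in
/-- The coordinates of `c`, restricted to the subset given by an indicator function. -/
noncomputable def truncate {I : Type u} (c : I → R) (ε : I → Bool) (k : I) : R :=
  if ε k then c k else 0

variable {I : Type u} (b : Module.Basis I ℤ (LocallyConstant S ℤ))

/-- The measure with given coordinates with respect to a basis of the module of locally constant
functions. -/
noncomputable def ofCoords : (I → R) →ₗ[R] limFree R S :=
  ofFunctional ∘ₗ (b.constr R).toLinearMap

theorem ofCoords_mem {A : Set R} {c : I → R} (hc : ∀ k, c k ∈ Subring.closure A)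
    (i : DiscreteQuotient S) (a : i) :
    limFreeProj R S i (ofCoords b c) a ∈ Subring.closure A :=
  ofFunctional_mem b (fun k => by
    change b.constr R c (b k) ∈ _
    rw [b.constr_basis]
    exact hc k) i a

theorem ofCoords_pairing (μ : limFree R S) : ofCoords b (fun k => pairing μ (b k)) = μ := by
  refine Eq.trans ?_ (ofFunctional_pairing μ)
  change ofFunctional (b.constr R _) = _
  congr 1
  exact b.ext fun k => b.constr_basis R _ k

theorem truncate_mem {A : Set R} {c : I → R} (hc : ∀ k, c k ∈ Subring.closure A) (ε : I → Bool)
    (k : I) : truncate c ε k ∈ Subring.closure A := by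
  unfold truncate
  split_ifs
  · exact hc k
  · exact zero_mem _

variable [TopologicalSpace R] [DiscreteTopology R]

/-- A section of `R_■[S]` takes values in bounded measures. -/
noncomputable def boundedValue {T : Profinite.{u}} (g : solidSections R S T) (t : T) : boundedMeasures R S :=
  ⟨g.1 t, g.2.imp fun _ ⟨hA, h⟩ => ⟨hA, h t⟩⟩

/-- The coefficients at a finite level involve only the finitely many basis elements occurring in
the indicators of its classes, so they are unchanged when ε varies outside these. -/
theorem continuous_ofCoords_truncate (c : I → R) :
    Continuous fun ε : I → Bool => (show limFreeTop R S from ofCoords b (truncate c ε)) := by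
  rw [continuous_iff_continuousAt]
  intro ε
  rw [ContinuousAt, ← tendsto_sub_nhds_zero_iff]
  refine (limFreeOpens R S).hasBasis.tendsto_right_iff.2 ?_
  rintro U ⟨i, hi⟩
  have hfin : (⋃ a : i, ((b.repr (fiberFun i a)).support : Set I)).Finite :=
    Set.finite_iUnion fun a => Finset.finite_toSet _
  have hopen : IsOpen (⋂ k ∈ ⋃ a : i, ((b.repr (fiberFun i a)).support : Set I),
      (fun ε' : I → Bool => ε' k) ⁻¹' {ε k}) :=
    hfin.isOpen_biInter fun k _ =>
      (isOpen_discrete ({ε k} : Set Bool)).preimage (continuous_apply k)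
  filter_upwards [hopen.mem_nhds (by simp)] with ε' hε'
  refine hi (LinearMap.mem_ker.2 ?_)
  change limFreeProj R S i (ofCoords b (truncate c ε')) -
    limFreeProj R S i (ofCoords b (truncate c ε)) = 0
  rw [sub_eq_zero]
  ext a
  change b.constr R _ (fiberFun i a) = b.constr R _ (fiberFun i a)
  rw [b.constr_apply, b.constr_apply]
  refine Finsupp.sum_congr fun k hk => ?_
  have := Set.mem_iInter₂.1 hε' k (Set.mem_iUnion.2 ⟨a, hk⟩)
  unfold truncate
  rw [show ε' k = ε k from this]

/-- The section of `R_■[S]` parametrizing the truncations of a bounded measure. -/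
noncomputable def truncationSection {A : Set R} (hA : A.Finite) {c : I → R}
    (hc : ∀ k, c k ∈ Subring.closure A) : solidSections R S (Profinite.of (I → Bool)) :=
  ⟨⟨_, continuous_ofCoords_truncate b c⟩, A, hA, fun ε i a => ofCoords_mem b (truncate_mem hc ε) i a⟩

variable {M : Type u} [AddCommGroup M] [Module R M] [TopologicalSpace M]
  (D : boundedMeasures R S →ₗ[R] M)

/-- Continuity at the empty truncation: a neighbourhood of it in {0,1}^I constrains only finitely
many coordinates. -/
theorem exists_finset_truncate
    (hD : ∀ (T : Profinite.{u}) (g : solidSections R S T), Continuous fun t => D (boundedValue g t))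
    {A : Set R} (hA : A.Finite) {c : I → R}
    (hc : ∀ k, c k ∈ Subring.closure A) (N : Submodule R M) (hN : IsOpen (N : Set M)) :
    ∃ J : Finset I, ∀ ε : I → Bool, (∀ k ∈ J, ε k = false) →
      D ⟨ofCoords b (truncate c ε), A, hA, ofCoords_mem b (truncate_mem hc ε)⟩ ∈ N := by
  have h0 : D (boundedValue (truncationSection b hA hc) fun _ => false) = 0 := by
    rw [← map_zero D]
    congr 1
    refine Subtype.ext ?_
    change ofCoords b (truncate c fun _ => false) = 0
    rw [← map_zero (ofCoords b)]
    rfl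
  have h1 := (hD _ (truncationSection b hA hc)).continuousAt (x := fun _ => false)
  have h2 := h1.preimage_mem_nhds (hN.mem_nhds (by rw [h0]; exact N.zero_mem))
  rw [nhds_pi, Filter.mem_pi'] at h2
  obtain ⟨J, t, ht, hJ⟩ := h2
  refine ⟨J, fun ε hε => ?_⟩
  refine hJ (a := ε) fun k hk => ?_
  rw [hε k hk]
  exact mem_of_mem_nhds (ht k)

/-- A linear map on bounded measures that is continuous on sections and vanishes on Dirac measures
is zero. -/
theorem eq_zero_of_boundedDirac [IsTopologicalAddGroup M] [IsLinearTopology R M] [T2Space M]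
    (hD : ∀ (T : Profinite.{u}) (g : solidSections R S T), Continuous fun t => D (boundedValue g t))
    (h0 : ∀ s, D (boundedDirac R s) = 0) : D = 0 := by
  classical
  let b := Module.Free.chooseBasis ℤ (LocallyConstant S ℤ)
  ext1 μ
  rw [LinearMap.zero_apply]
  by_contra hμ
  obtain ⟨N, hN, hNμ⟩ := (IsLinearTopology.hasBasis_open_submodule R).mem_iff.1
    (isOpen_compl_singleton.mem_nhds (Ne.symm hμ) : {D μ}ᶜ ∈ nhds 0)
  refine hNμ (a := D μ) ?_ rfl
  clear hNμ hμ
  have hone : ∀ _ : Module.Free.ChooseBasisIndex ℤ (LocallyConstant S ℤ),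
    (1 : R) ∈ Subring.closure ∅ := fun _ => one_mem _
  -- The constant family 1 gives a finite set that does not depend on any measure. Singleton
  -- truncations of this family are the basis measures `e k`.
  obtain ⟨J₀, hJ₀⟩ := exists_finset_truncate b D hD Set.finite_empty hone N hN
  let e (k) : boundedMeasures R S := ⟨ofCoords b (Pi.single k 1), ∅, Set.finite_empty,
    ofCoords_mem b fun l => by
      rw [Pi.single_apply]; split_ifs; exacts [one_mem _, zero_mem _]⟩
  have he (k) (hk : k ∉ J₀) : D (e k) ∈ N := by
    have h1 := hJ₀ (fun l => decide (l = k)) fun l hl =>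
      decide_eq_false fun h : l = k => hk (h ▸ hl)
    have h2 : truncate (fun _ => (1 : R)) (fun l => decide (l = k)) = Pi.single k 1 := by
      funext l
      simp [truncate, Pi.single_apply]
    simpa only [h2] using h1
  -- The measure is a tail sent into N plus finitely many multiples of the `e k`. For `k` in `J₀`
  -- the coefficient vanishes, and for other `k` the map D sends `e k` into N.
  have key (ν : boundedMeasures R S) (hν : ∀ k ∈ J₀, pairing ν.1 (b k) = 0) : D ν ∈ N := by
    obtain ⟨A, hA, hc⟩ := exists_closure_pairing_mem ν.2
    have hc' (k) := hc (b k)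
    obtain ⟨J, hJ⟩ := exists_finset_truncate b D hD hA hc' N hN
    have h1 := hJ (fun k => decide (k ∉ J)) (by simp)
    have h2 : ν = (⟨ofCoords b (truncate (fun k => pairing ν.1 (b k)) fun k => decide (k ∉ J)), A,
        hA, ofCoords_mem b (truncate_mem hc' _)⟩ : boundedMeasures R S) +
        ∑ k ∈ J, pairing ν.1 (b k) • e k := by
      refine Subtype.ext ?_
      rw [Submodule.coe_add, Submodule.coe_sum]
      change ν.1 = ofCoords b _ + ∑ k ∈ J, pairing ν.1 (b k) • ofCoords b (Pi.single k 1)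
      simp only [← map_smul]
      rw [← map_sum, ← map_add]
      refine (ofCoords_pairing b ν.1).symm.trans (congrArg _ ?_)
      funext k
      by_cases hk : k ∈ J <;> simp [truncate, hk, Finset.sum_apply, Pi.single_apply]
    rw [h2, map_add, map_sum]
    refine N.add_mem h1 (N.sum_mem fun k _ => ?_)
    rw [map_smul]
    by_cases hk : k ∈ J₀
    · rw [hν k hk, zero_smul]
      exact N.zero_mem
    · exact N.smul_mem _ (he k hk)
  choose i hi using fun k => exists_fiberConst_castFun (R := R) (b k)
  -- A level fine enough to compute the `J₀`-coordinates exactly. The Dirac combination `δ` at this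
  -- level then has the same `J₀`-coordinates as `μ`.
  let j := J₀.inf i
  let δ : boundedMeasures R S := riemannSum (boundedDirac R) j μ.1
  have hδ : D δ = 0 := by
    refine (map_riemannSum D (boundedDirac R) j μ.1).trans ?_
    rw [show D ∘ boundedDirac R = 0 from funext h0]
    exact Finset.sum_eq_zero fun _ _ => smul_zero _
  have hδ' : δ.1 = riemannSum (diracMeasure (R := R)) j μ.1 :=
    map_riemannSum (boundedMeasures R S).subtype (boundedDirac R) j μ.1
  have h3 := key (μ + (-1 : R) • δ) fun k hk => by
    have hj := (hi k).of_le (Finset.inf_le hk : j ≤ i k)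
    rw [pairing_eq hj, Submodule.coe_add, Submodule.coe_smul, map_add, map_smul, hδ',
      riemannSum_riemannSum_dirac, neg_one_smul, add_neg_cancel]
  rwa [map_add, map_smul, hδ, smul_zero, add_zero] at h3

end Uniqueness

/-! ### Solidity of realizations -/

section Solidity

variable {R : Type u} [CommRing R] [TopologicalSpace R] [DiscreteTopology R] {S : Profinite.{u}}

/-- The constant section defined by a bounded measure. -/
noncomputable def constSection (μ : boundedMeasures R S) :
    solidSections R S (Profinite.of PUnit.{u + 1}) :=
  ⟨ContinuousMap.const _ μ.1, μ.2.imp fun _ ⟨hA, h⟩ => ⟨hA, fun _ => h⟩⟩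

variable {M : TopModuleCat.{u} R}

/-- The linear map on bounded measures underlying a morphism `R_■[S] ⟶ C⁰(-, M)`. -/
noncomputable def onMeasures (φ : solidFree R S ⟶ contSheaf.obj M) :
    boundedMeasures R S →ₗ[R] M where
  toFun μ := (show C(Profinite.of PUnit.{u + 1}, M) from
    φ.hom.app (op (Profinite.of PUnit.{u + 1})) (constSection μ)) PUnit.unit
  map_add' μ ν := congrArg (fun k : C(Profinite.of PUnit.{u + 1}, M) => k PUnit.unit)
    (map_add (φ.hom.app (op (Profinite.of PUnit.{u + 1}))).hom (constSection μ) (constSection ν))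
  map_smul' r μ := congrArg (fun k : C(Profinite.of PUnit.{u + 1}, M) => k PUnit.unit)
    (map_smul (φ.hom.app (op (Profinite.of PUnit.{u + 1}))).hom r (constSection μ))

theorem onMeasures_boundedValue (φ : solidFree R S ⟶ contSheaf.obj M) (T : Profinite.{u})
    (g : solidSections R S T) (t : T) :
    onMeasures φ (boundedValue g t) = (show C(T, M) from φ.hom.app (op T) g) t := by
  let c : Profinite.of PUnit.{u + 1} ⟶ T :=
    CompHausLike.ofHom _ (ContinuousMap.const _ t)
  have := NatTrans.naturality_apply φ.hom c.op g
  exact congrArg (fun k : C(Profinite.of PUnit.{u + 1}, M) => k PUnit.unit) this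

/-- By naturality a morphism is recovered from its effect on bounded measures. The difference of two
morphisms with the same restriction kills Dirac measures and is continuous on sections. -/
theorem restrictDirac_injective [IsLinearTopology R M] [T2Space M] :
    Function.Injective (restrictDirac S (contSheaf.obj M)) := by
  intro φ ψ h
  have hD : onMeasures φ - onMeasures ψ = 0 := by
    refine eq_zero_of_boundedDirac _ (fun T g => ?_) fun s => ?_
    · have e : (fun t => (onMeasures φ - onMeasures ψ) (boundedValue g t)) = fun t =>
          (show C(T, M) from φ.hom.app (op T) g) t - (show C(T, M) from ψ.hom.app (op T) g) t :=
        funext fun t => by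
          rw [LinearMap.sub_apply, onMeasures_boundedValue, onMeasures_boundedValue]
      rw [e]
      exact (ContinuousMap.continuous _).sub (ContinuousMap.continuous _)
    · rw [LinearMap.sub_apply, sub_eq_zero]
      refine (onMeasures_boundedValue φ S (diracSection R S) s).trans
        (Eq.trans ?_ (onMeasures_boundedValue ψ S (diracSection R S) s).symm)
      exact congrArg (fun k : C(S, M) => k s) h
  rw [sub_eq_zero] at hD
  apply Sheaf.hom_ext
  ext T g
  refine ContinuousMap.ext fun t => ?_
  exact (onMeasures_boundedValue φ T.unop g t).symm.trans
    ((LinearMap.congr_fun hD _).trans (onMeasures_boundedValue ψ T.unop g t))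

/-- The morphism of sheaves defined by a continuous linear map. -/
noncomputable def ofContinuousLinear (L : limFreeTop R S →L[R] M) :
    solidFree R S ⟶ contSheaf.obj M :=
  ⟨{ app T := ModuleCat.ofHom
      { toFun g := (⟨L, L.continuous⟩ : C(limFreeTop R S, M)).comp g.1
        map_add' f g := by ext x; exact map_add L (f.1 x) (g.1 x)
        map_smul' r f := by ext x; exact map_smul L r (f.1 x) }
     naturality _ _ _ := rfl }⟩

/-- Integration of a continuous function with values in a complete linearly topologized module with
a countable basis of open submodules. -/
theorem exists_integral (f : C(S, M)) (U : ℕ → Submodule R M)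
    (hU : (nhds (0 : M)).HasBasis (fun _ => True) (fun n => (U n : Set M))) (hanti : Antitone U)
    (hsep : ∀ x, (∀ n, x ∈ U n) → x = 0)
    (hcomp : ∀ x : ℕ → M, (∀ n, x (n + 1) - x n ∈ U n) → ∃ y, ∀ n, y - x n ∈ U n) :
    ∃ L : limFreeTop R S →L[R] M, ∀ s, L (dirac R S s) = f s := by
  have hopen (n : ℕ) : IsOpen (U n : Set M) :=
    (U n).toAddSubgroup.isOpen_of_mem_nhds (hU.mem_of_mem trivial)
  have hi (n : ℕ) : ∃ i : DiscreteQuotient S, FiberConst f (U n) i :=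
    exists_fiberConst _ _ fun s => (hopen n).preimage (continuous_const.sub f.continuous)
  choose i hi using hi
  -- The levels `i n` and `i (n + 1)` are both adapted to `U n`, so consecutive sums differ by an
  -- element of `U n` and completeness yields the integral.
  have hy (μ : limFree R S) : ∃ y, ∀ n, y - riemannSum f (i n) μ ∈ U n :=
    hcomp (fun n => riemannSum f (i n) μ) fun n =>
      riemannSum_sub_mem' (fun s s' h => hanti n.le_succ (hi (n + 1) s s' h)) (hi n) μ
  choose y hy using hy
  have huniq (μ : limFree R S) (z : M) (hz : ∀ n, z - riemannSum f (i n) μ ∈ U n) : y μ = z := by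
    rw [← sub_eq_zero]
    refine hsep _ fun n => ?_
    rw [← sub_sub_sub_cancel_right _ _ (riemannSum f (i n) μ)]
    exact (U n).sub_mem (hy μ n) (hz n)
  let L : limFree R S →ₗ[R] M :=
    { toFun := y
      map_add' := fun μ ν => huniq _ _ fun n => by
        rw [map_add, add_sub_add_comm]
        exact (U n).add_mem (hy μ n) (hy ν n)
      map_smul' := fun r μ => huniq _ _ fun n => by
        rw [map_smul, RingHom.id_apply, ← smul_sub]
        exact (U n).smul_mem r (hy μ n) }
  let L' : limFreeTop R S →ₗ[R] M := L
  have hL : Continuous L' := by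
    refine continuous_of_continuousAt_zero L' ?_
    rw [ContinuousAt, map_zero]
    -- A measure vanishing at level `i n` has `n`-th Riemann sum zero, so its integral lies in `U
    -- n`.
    refine ((limFreeOpens R S).hasBasis.tendsto_iff hU).2 fun n _ =>
      ⟨LinearMap.ker (limFreeProj R S (i n)), ⟨i n, le_rfl⟩, fun μ hμ => ?_⟩
    have h0 : riemannSum f (i n) (show limFree R S from μ) = 0 := by
      change Finsupp.linearCombination R _ (limFreeProj R S (i n) μ) = 0
      rw [show limFreeProj R S (i n) μ = 0 from hμ, map_zero]
    have := hy μ n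
    rwa [h0, sub_zero] at this
  refine ⟨⟨L', hL⟩, fun s => huniq (diracMeasure s) (f s) fun n => ?_⟩
  rw [riemannSum_dirac]
  exact hi n _ _ (proj_quotSection _ _).symm

/-- Modules of continuous maps to a retract of a complete module with a countable basis of open
submodules are solid. -/
theorem restrictDirac_surjective {N : TopModuleCat.{u} R} (j : M ⟶ N) (r : N ⟶ M)
    (hjr : ∀ x, r.hom (j.hom x) = x)
    (hN : ∀ f : C(S, N), ∃ L : limFreeTop R S →L[R] N, ∀ s, L (dirac R S s) = f s) :
    Function.Surjective (restrictDirac S (contSheaf.obj M)) := by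
  intro (f : C(S, M))
  obtain ⟨L, hL⟩ := hN ((⟨j.hom, j.hom.continuous⟩ : C(M, N)).comp f)
  refine ⟨ofContinuousLinear (r.hom.comp L), ?_⟩
  refine ContinuousMap.ext fun s => ?_
  change r.hom (L (dirac R S s)) = f s
  rw [hL]
  exact hjr _

/-- Injectivity needs only a Hausdorff linear topology, so it is applied to V directly. Surjectivity
needs completeness, available on the elementary object of which V is a retract. -/
theorem bijective_restrictDirac_realization (V : Tate R) (S : Profinite.{u}) :
    Function.Bijective (restrictDirac S ((underline R).obj ((realization R).obj V))) := by
  have hcg := isCGWH_realization V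
  have h2 : T2Space ((realization R).obj V).obj := hcg.2.t2Space
  have : IsLinearTopology R ((realization R).obj V).obj := ((realization R).obj V).property
  refine ⟨restrictDirac_injective (M := ((realization R).obj V).obj), ?_⟩
  obtain ⟨V', p, j, r, hjr⟩ := retractClosure_isElementaryTate V.property
  refine restrictDirac_surjective (M := ((realization R).obj V).obj)
    ((presheafRealization R).map j).hom ((presheafRealization R).map r).hom (fun x => ?_)
    fun f => ?_
  · have := congrArg (fun k => Points.map k x) hjr
    exact this
  · obtain ⟨U, hU, hanti, hbasis, hsep, hcomp⟩ := p.exists_basis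
    refine exists_integral f U ⟨fun t => ?_⟩ hanti hsep hcomp
    refine (tateOpens V').hasBasis.mem_iff.trans ⟨?_, ?_⟩
    · rintro ⟨W, hW, hWt⟩
      obtain ⟨n, hn⟩ := hbasis W hW
      exact ⟨n, trivial, fun x hx => hWt (hn hx)⟩
    · rintro ⟨n, -, hn⟩
      exact ⟨U n, hU n, hn⟩

end Solidity

end TateCond

/-! ### The proposition -/

theorem proposition1p5 (R : Type u) [CommRing R] [TopologicalSpace R] [DiscreteTopology R] :
    ∃ (hτ : ∀ V : TateCond.Tate R, TateCond.isCGWH R ((TateCond.realization R).obj V))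
      (hC : ∀ M : TateCond.TopModCGWH R, TateCond.isCondensed R ((TateCond.underline R).obj M.obj)),
      let τ : TateCond.Tate R ⥤ TateCond.TopModCGWH R :=
        (TateCond.isCGWH R).lift (TateCond.realization R) hτ
      let C : TateCond.TopModCGWH R ⥤ TateCond.Cond R :=
        (TateCond.isCondensed R).lift ((TateCond.isCGWH R).ι ⋙ TateCond.underline R) hC
      let TC : TateCond.Tate R ⥤ TateCond.Cond R := τ ⋙ C
      TC.Full ∧ TC.Faithful ∧
        ∃ hS : ∀ V : TateCond.Tate R, TateCond.isSolid R (TC.obj V),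
          let TS : TateCond.Tate R ⥤ TateCond.Solid R := (TateCond.isSolid R).lift TC hS
          TS.Full ∧ TS.Faithful := by
  have hτ := TateCond.isCGWH_realization (R := R)
  have hC (M : TateCond.TopModCGWH R) :
      TateCond.isCondensed R ((TateCond.underline R).obj M.obj) :=
    TateCond.isCondensed_underline M.obj M.property.2
  refine ⟨hτ, hC, ?_⟩
  intro τ C TC
  have hfull : TC.Full := ⟨fun {V W} ψ => by
    -- Compact generation of the source turns the sheaf morphism into a continuous map, which
    -- fullness of the realization lifts to Tate modules.
    obtain ⟨F, hF⟩ := TateCond.exists_underline_map_eq (hτ V).1 ψ.hom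
    obtain ⟨φ, rfl⟩ := (TateCond.realization R).map_surjective F
    exact ⟨φ, ObjectProperty.hom_ext _ hF⟩⟩
  have hfaithful : TC.Faithful := ⟨fun {V W φ ψ} h =>
    (TateCond.realization R).map_injective
      (TateCond.underline_map_injective (congrArg (fun k => k.hom) h))⟩
  refine ⟨hfull, hfaithful, fun V S _ => TateCond.bijective_restrictDirac_realization V S, ?_⟩
  intro TS
  refine ⟨⟨fun {V W} ψ => ?_⟩, ⟨fun {V W φ ψ} h => ?_⟩⟩
  · obtain ⟨φ, hφ⟩ := TC.map_surjective ψ.hom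
    exact ⟨φ, ObjectProperty.hom_ext _ hφ⟩
  · exact TC.map_injective (congrArg (fun k => k.hom) h)
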